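/- Let $A:\mathbb R^3\to\mathbb R^3$ and $V:\mathbb R^3\to\mathbb R$ satisfy $A_k,V\in L^2_{loc}(\mathbb R^3)$, and let $V$ be infinitesimally small with respect to $-\Delta$: for every $\varepsilon>0$ there is $C_\varepsilon$ such that $\|V\varphi\|\le\varepsilon\|\Delta\varphi\|+C_\varepsilon\|\varphi\|$ for all $\varphi\in C_0^\infty(\mathbb R^3)$, where $\|\cdot\|$ is the $L^2$-norm. Let $D_A=-i\nabla+A$ in the sense of distributions, let $H^1_A(\mathbb R^3)=\{\varphi\in L^2(\mathbb R^3;\mathbb C): D_A\varphi\in L^2(\mathbb R^3;\mathbb C^3)\}$, and let $H^1_{(A,A)}(\mathbb R^6)$ be the space of all $\psi\in L^2(\mathbb R^3\times\mathbb R^3;\mathbb C)$ with $D_{A,x_1}\psi,\,D_{A,x_2}\psi\in L^2$, where $D_{A,x_k}=-i\nabla_{x_k}+A(x_k)$. Define the Pekar functional on $H^1_A(\mathbb R^3)$ by $$\mathcal E^{A,V}(\varphi)=\int\big(|D_A\varphi|^2+V|\varphi|^2\big)\,dx-\int\frac{|\varphi(x)|^2|\varphi(y)|^2}{|x-y|}\,dx\,dy,\qquad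 C^{A,V}(1)=\inf\{\mathcal E^{A,V}(\varphi):\varphi\in H^1_A(\mathbb R^3),\ \|\varphi\|=1\},$$ and, for $U\in\mathbb R$, the Pekar–Tomasevich functional on $H^1_{(A,A)}(\mathbb R^6)$ by $$\mathcal E^{A,V}_U(\psi)=\sum_{k=1}^2\int\big(|D_{A,x_k}\psi|^2+V(x_k)|\psi|^2\big)\,dx_1dx_2+U\int\frac{|\psi(x_1,x_2)|^2}{|x_1-x_2|}\,dx_1dx_2-\int\frac{\rho(x_1)\rho(x_2)}{|x_1-x_2|}\,dx_1dx_2,$$ with $\rho(x)=\int(|\psi(x,y)|^2+|\psi(y,x)|^2)\,dy$ and $C^{A,V}_U=\inf\{\mathcal E^{A,V}_U(\psi):\psi\in H^1_{(A,A)}(\mathbb R^6),\ \|\psi\|=1\}$. **Theorem.** Suppose that $\mathcal E^{A,V}$ has a minimizer, i.e. there is $\varphi_0\in H^1_A(\mathbb R^3)$ with $\|\varphi_0\|=1$ and $\mathcal E^{A,V}(\varphi_0)=C^{A,V}(1)$. Then there exists $U_A>2$ such that $C^{A,V}_U<2\,C^{A,V}(1)$ for all $U$ with $2<U<U_A$.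 -/

import Mathlib

open MeasureTheory Laplacian
open scoped ContDiff NNReal

namespace Polaron

/-- Configuration space of one particle. The configuration space of two particles is the
product `R3 × R3`, with its product Lebesgue measure. -/
abbrev R3 : Type := EuclideanSpace ℝ (Fin 3)

/-- `f ∈ L²_loc(ℝ³)`. -/
def L2Loc (f : R3 → ℝ) : Prop :=
  ∀ K : Set R3, IsCompact K → MemLp f 2 (volume.restrict K)

/-- `V` is infinitesimally small with respect to `-Δ`: for every `ε > 0` there is `C` such that
`‖V φ‖ ≤ ε ‖Δ φ‖ + C ‖φ‖` for all `φ ∈ C₀^∞(ℝ³)`, with `L²`-norms. -/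
def InfinitesimallySmall (V : R3 → ℝ) : Prop :=
  ∀ ε : ℝ≥0, 0 < ε → ∃ C : ℝ≥0, ∀ φ : R3 → ℂ, ContDiff ℝ ∞ φ → HasCompactSupport φ →
    eLpNorm (fun x => (V x : ℂ) * φ x) 2 volume
      ≤ ε * eLpNorm (Δ φ) 2 volume + C * eLpNorm φ 2 volume

section MagneticDerivative

variable {E : Type*} [NormedAddCommGroup E] [NormedSpace ℝ E] [MeasureSpace E]

/-- The distribution `-i ∂_v ψ + a ψ` is represented by the `L²` function `g`. The distributional
derivative in the direction `v` is moved to the test function `η`, which changes the sign. -/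
def HasMagneticDeriv (v : E) (a : E → ℝ) (ψ g : E → ℂ) : Prop :=
  MemLp g 2 volume ∧
    ∀ η : E → ℂ, ContDiff ℝ ∞ η → HasCompactSupport η →
      ∫ x, g x * η x = ∫ x, ψ x * (Complex.I * fderiv ℝ η x v + (a x : ℂ) * η x)

open Classical in
/-- The `L²` function `-i ∂_v ψ + a ψ` (unique up to null sets), if it exists; `0` otherwise. -/
noncomputable def magneticDeriv (v : E) (a : E → ℝ) (ψ : E → ℂ) : E → ℂ :=
  if h : ∃ g, HasMagneticDeriv v a ψ g then h.choose else 0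

end MagneticDerivative

/-- The `j`-th standard unit vector of `ℝ³`. -/
noncomputable def e (j : Fin 3) : R3 := EuclideanSpace.single j 1

/-- The `j`-th component of `D_A φ = (-i∇ + A) φ`. -/
noncomputable def D (A : R3 → R3) (j : Fin 3) (φ : R3 → ℂ) : R3 → ℂ :=
  magneticDeriv (e j) (fun x => A x j) φ

/-- The `j`-th component of `D_{A,x₁} ψ`. -/
noncomputable def D₁ (A : R3 → R3) (j : Fin 3) (ψ : R3 × R3 → ℂ) : R3 × R3 → ℂ :=
  magneticDeriv (e j, (0 : R3)) (fun x => A x.1 j) ψ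

/-- The `j`-th component of `D_{A,x₂} ψ`. -/
noncomputable def D₂ (A : R3 → R3) (j : Fin 3) (ψ : R3 × R3 → ℂ) : R3 × R3 → ℂ :=
  magneticDeriv ((0 : R3), e j) (fun x => A x.2 j) ψ

/-- The magnetic Sobolev space `H¹_A(ℝ³)`. -/
def H1 (A : R3 → R3) : Set (R3 → ℂ) :=
  {φ | MemLp φ 2 volume ∧ ∀ j : Fin 3, ∃ g, HasMagneticDeriv (e j) (fun x => A x j) φ g}

/-- The magnetic Sobolev space `H¹_{(A,A)}(ℝ⁶)`. -/
def H1Pair (A : R3 → R3) : Set (R3 × R3 → ℂ) :=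
  {ψ | MemLp ψ 2 volume ∧
    (∀ j : Fin 3, ∃ g, HasMagneticDeriv (e j, (0 : R3)) (fun x => A x.1 j) ψ g) ∧
    (∀ j : Fin 3, ∃ g, HasMagneticDeriv ((0 : R3), e j) (fun x => A x.2 j) ψ g)}

/-- The Coulomb self-energy `∫∫ ρ(x) ρ(y) / |x - y| dx dy`. -/
noncomputable def coulomb (ρ : R3 → ℝ) : ℝ :=
  ∫ p : R3 × R3, ρ p.1 * ρ p.2 / ‖p.1 - p.2‖

/-- The Pekar functional `∫ (|D_A φ|² + V |φ|²) dx - ∫∫ |φ(x)|² |φ(y)|² / |x - y| dx dy`. -/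
noncomputable def pekar (A : R3 → R3) (V : R3 → ℝ) (φ : R3 → ℂ) : ℝ :=
  (∫ x, ((∑ j, ‖D A j φ x‖ ^ 2) + V x * ‖φ x‖ ^ 2)) - coulomb (fun x => ‖φ x‖ ^ 2)

/-- `φ ∈ H¹_A(ℝ³)` with `‖φ‖² = lam`. -/
def pekarDomain (A : R3 → R3) (lam : ℝ) : Set (R3 → ℂ) :=
  {φ | φ ∈ H1 A ∧ ∫ x, ‖φ x‖ ^ 2 = lam}

/-- `C^{A,V}(lam)`, the infimum of the Pekar functional over `‖φ‖² = lam`, taken in the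
extended reals. -/
noncomputable def pekarEnergy (A : R3 → R3) (V : R3 → ℝ) (lam : ℝ) : EReal :=
  ⨅ φ ∈ pekarDomain A lam, (pekar A V φ : EReal)

/-- `φ` is a minimizer of the Pekar functional subject to `‖φ‖ = 1`. -/
def IsPekarMinimizer (A : R3 → R3) (V : R3 → ℝ) (φ : R3 → ℂ) : Prop :=
  φ ∈ pekarDomain A 1 ∧ IsMinOn (pekar A V) (pekarDomain A 1) φ

/-- The density `ρ(x) = ∫ (|ψ(x,y)|² + |ψ(y,x)|²) dy` of a two-particle state. -/
noncomputable def pairDensity (ψ : R3 × R3 → ℂ) (x : R3) : ℝ :=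
  ∫ y, (‖ψ (x, y)‖ ^ 2 + ‖ψ (y, x)‖ ^ 2)

/-- The Pekar-Tomasevich functional. -/
noncomputable def pekarTomasevich (A : R3 → R3) (V : R3 → ℝ) (U : ℝ) (ψ : R3 × R3 → ℂ) : ℝ :=
  (∫ x, ((∑ j, ‖D₁ A j ψ x‖ ^ 2) + V x.1 * ‖ψ x‖ ^ 2))
    + (∫ x, ((∑ j, ‖D₂ A j ψ x‖ ^ 2) + V x.2 * ‖ψ x‖ ^ 2))
    + U * (∫ x, ‖ψ x‖ ^ 2 / ‖x.1 - x.2‖)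
    - coulomb (pairDensity ψ)

/-- `C^{A,V}_U`, the infimum of the Pekar-Tomasevich functional over `‖ψ‖ = 1`, taken in the
extended reals. -/
noncomputable def pairEnergy (A : R3 → R3) (V : R3 → ℝ) (U : ℝ) : EReal :=
  ⨅ ψ ∈ {ψ : R3 × R3 → ℂ | ψ ∈ H1Pair A ∧ ∫ x, ‖ψ x‖ ^ 2 = 1},
    (pekarTomasevich A V U ψ : EReal)

end Polaron

/-!
For a state `ψ` and a bounded smooth real function `f`, the state with the phase of `ψ` and the
density `(1 + s f) |ψ|²` has kinetic and potential energy differing from that of `ψ` by a linear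
term in `s` and an error `O(s²)`. If `φ` minimizes the Pekar functional, then comparison with such
states shows that the linear term is balanced by the variation of the Coulomb energy whenever
`∫ f |φ|² = 0`.

Apply the same modulation, with a symmetric correlation `w(x, y)` of mean zero, to `φ ⊗ φ`. At
`U = 2` the pair energy of `φ ⊗ φ` is twice the Pekar energy of `φ`, and by the Euler–Lagrange
equation tested with `w̃(x) = ∫ w(x, y) |φ(y)|² dy` its derivative in `s` is twice
`∫ (w(x, y) - 2 w̃(x)) |φ(x)|² |φ(y)|² / |x - y|`. Since `1 / |x - y|` is unbounded near the
diagonal while the Coulomb potential of `|φ|²` is bounded, this does not vanish if `w` is, up to a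
constant, a bump concentrated near the diagonal. A small `s` of the right sign therefore gives a
pair state of energy below twice the Pekar energy, and this persists for `U` slightly above `2`
because the energy of a fixed state is continuous in `U`.
-/

namespace Polaron

/-! ### Magnetic derivatives -/

section Multiplier

lemma memLp_bdd_mul {α : Type*} [MeasurableSpace α] {μ : Measure α} {p : ENNReal} {f g : α → ℂ}
    (hg : MemLp g p μ) (hf : AEStronglyMeasurable f μ) {C : ℝ} (hC : ∀ x, ‖f x‖ ≤ C) :
    MemLp (fun x => f x * g x) p μ :=
  hg.mul' (memLp_top_of_bound hf C (.of_forall hC))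

variable {E : Type*} [NormedAddCommGroup E] [MeasureSpace E] [BorelSpace E]

lemma integrable_mul_test [IsFiniteMeasureOnCompacts (volume : Measure E)] {ψ : E → ℂ}
    (hψ : MemLp ψ 2 volume) {η : E → ℂ} (hη : Continuous η)
    (hs : HasCompactSupport η) : Integrable (fun x => ψ x * η x) volume :=
  hψ.integrable_mul (hη.memLp_of_hasCompactSupport hs : MemLp η 2 volume)

lemma memLp_mul_of_hasCompactSupport {a : E → ℝ}
    (ha : ∀ K : Set E, IsCompact K → MemLp a 2 (volume.restrict K)) {η : E → ℂ}
    (hη : Continuous η) (hs : HasCompactSupport η) :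
    MemLp (fun x => (a x : ℂ) * η x) 2 volume := by
  obtain ⟨C, hC⟩ := hη.bounded_above_of_compact_support hs
  have hsupp : (tsupport η).indicator (fun x => (a x : ℂ) * η x) = fun x => (a x : ℂ) * η x :=
    Set.indicator_eq_self.2 ((Function.support_mul_subset_right _ _).trans (subset_tsupport η))
  rw [← hsupp, memLp_indicator_iff_restrict (isClosed_tsupport η).measurableSet]
  exact (memLp_bdd_mul (ha _ hs.isCompact).ofReal hη.aestronglyMeasurable hC).ae_eq
    (.of_forall fun x => mul_comm _ _)

end Multiplier

lemma continuous_fderiv_apply {E F : Type*} [NormedAddCommGroup E] [NormedSpace ℝ E]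
    [NormedAddCommGroup F] [NormedSpace ℝ F] {f : E → F}
    (hf : ContDiff ℝ ∞ f) (v : E) : Continuous fun x => fderiv ℝ f x v :=
  (hf.continuous_fderiv (by simp)).clm_apply continuous_const

/-- Smooth real functions that are bounded together with their first derivatives: the
multipliers that preserve the magnetic Sobolev spaces. -/
structure BoundedSmooth {E : Type*} [NormedAddCommGroup E] [NormedSpace ℝ E]
    (f : E → ℝ) : Prop where
  contDiff : ContDiff ℝ ∞ f
  exists_abs_le : ∃ C, ∀ x, |f x| ≤ C
  exists_norm_fderiv_le : ∃ C, ∀ x, ‖fderiv ℝ f x‖ ≤ C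

namespace BoundedSmooth

variable {E : Type*} [NormedAddCommGroup E] [NormedSpace ℝ E] {f : E → ℝ}

lemma of_hasCompactSupport (hf : ContDiff ℝ ∞ f) (hs : HasCompactSupport f) :
    BoundedSmooth f :=
  ⟨hf, hf.continuous.bounded_above_of_compact_support hs,
    (hf.continuous_fderiv (by simp)).bounded_above_of_compact_support (hs.fderiv ℝ)⟩

lemma exists_abs_fderiv_apply_le (hf : BoundedSmooth f) (v : E) :
    ∃ C, ∀ x, |fderiv ℝ f x v| ≤ C := by
  obtain ⟨C, hC⟩ := hf.exists_norm_fderiv_le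
  exact ⟨C * ‖v‖, fun x => (fderiv ℝ f x).le_of_opNorm_le (hC x) v⟩

variable [MeasureSpace E] [BorelSpace E] {ψ : E → ℂ}

lemma memLp_mul (hf : BoundedSmooth f) (hψ : MemLp ψ 2 volume) :
    MemLp (fun x => f x * ψ x) 2 volume := by
  obtain ⟨C, hC⟩ := hf.exists_abs_le
  exact memLp_bdd_mul hψ
    (Complex.continuous_ofReal.comp hf.contDiff.continuous).aestronglyMeasurable (by simpa using hC)

lemma memLp_fderiv_mul (hf : BoundedSmooth f) (v : E) (hψ : MemLp ψ 2 volume) :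
    MemLp (fun x => Complex.I * (fderiv ℝ f x v : ℝ) * ψ x) 2 volume := by
  obtain ⟨C, hC⟩ := hf.exists_abs_fderiv_apply_le v
  exact memLp_bdd_mul hψ (continuous_const.mul (Complex.continuous_ofReal.comp
    (continuous_fderiv_apply hf.contDiff v))).aestronglyMeasurable (by simpa using hC)

end BoundedSmooth

section MagneticDeriv

variable {E : Type*} [NormedAddCommGroup E] [NormedSpace ℝ E] [MeasureSpace E] {v : E} {a : E → ℝ}
  {ψ g g' : E → ℂ}

lemma hasMagneticDeriv_magneticDeriv (h : ∃ g, HasMagneticDeriv v a ψ g) :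
    HasMagneticDeriv v a ψ (magneticDeriv v a ψ) := by
  rw [magneticDeriv, dif_pos h]
  exact h.choose_spec

variable [BorelSpace E] [IsFiniteMeasureOnCompacts (volume : Measure E)]

lemma HasMagneticDeriv.ae_unique [FiniteDimensional ℝ E] (h : HasMagneticDeriv v a ψ g)
    (h' : HasMagneticDeriv v a ψ g') : g =ᵐ[volume] g' := by
  refine ae_eq_of_integral_contDiff_smul_eq (h.1.locallyIntegrable (by norm_num))
    (h'.1.locallyIntegrable (by norm_num)) fun η hη hs => ?_
  have hη' : ContDiff ℝ ∞ (fun x => (η x : ℂ)) := Complex.ofRealCLM.contDiff.comp hη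
  have hs' : HasCompactSupport (fun x => (η x : ℂ)) := hs.comp_left (g := Complex.ofReal) rfl
  simpa [mul_comm] using (h.2 _ hη' hs').trans (h'.2 _ hη' hs').symm

lemma HasMagneticDeriv.magneticDeriv_ae_eq [FiniteDimensional ℝ E]
    (h : HasMagneticDeriv v a ψ g) : magneticDeriv v a ψ =ᵐ[volume] g :=
  (hasMagneticDeriv_magneticDeriv ⟨g, h⟩).ae_unique h

lemma integrable_mul_adjoint_test (hψ : MemLp ψ 2 volume)
    (ha : ∀ K : Set E, IsCompact K → MemLp a 2 (volume.restrict K)) {η : E → ℂ}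
    (hη : ContDiff ℝ ∞ η) (hs : HasCompactSupport η) (v : E) :
    Integrable (fun x => ψ x * (Complex.I * fderiv ℝ η x v + (a x : ℂ) * η x)) volume := by
  have hderiv := integrable_mul_test hψ (η := fun x => Complex.I * fderiv ℝ η x v)
    (continuous_const.mul (continuous_fderiv_apply hη v)) (hs.fderiv_apply (𝕜 := ℝ) v).mul_left
  have hpot : Integrable (fun x => ψ x * ((a x : ℂ) * η x)) volume :=
    hψ.integrable_mul (memLp_mul_of_hasCompactSupport ha hη.continuous hs)
  simp only [mul_add]
  exact hderiv.add hpot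

lemma HasMagneticDeriv.mul_boundedSmooth
    (ha : ∀ K : Set E, IsCompact K → MemLp a 2 (volume.restrict K)) (hψ : MemLp ψ 2 volume)
    (h : HasMagneticDeriv v a ψ g) {f : E → ℝ} (hf : BoundedSmooth f) :
    HasMagneticDeriv v a (fun x => f x * ψ x)
      (fun x => f x * g x - Complex.I * (fderiv ℝ f x v : ℝ) * ψ x) := by
  have hfc : ContDiff ℝ ∞ (fun x => (f x : ℂ)) := Complex.ofRealCLM.contDiff.comp hf.contDiff
  have hgrad := hf.memLp_fderiv_mul v hψ
  refine ⟨(hf.memLp_mul h.1).sub hgrad, fun η hη hs => ?_⟩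
  have hleibniz : ∀ x, fderiv ℝ (fun x => f x * η x) x v
      = f x * fderiv ℝ η x v + (fderiv ℝ f x v : ℝ) * η x := fun x => by
    have hfx : HasFDerivAt (fun x => (f x : ℂ)) (Complex.ofRealCLM.comp (fderiv ℝ f x)) x :=
      Complex.ofRealCLM.hasFDerivAt.comp x (hf.contDiff.differentiable (by simp) x).hasFDerivAt
    rw [(hfx.fun_mul (hη.differentiable (by simp) x).hasFDerivAt).fderiv]
    simp [mul_comm]
  simp only [sub_mul]
  rw [integral_sub (integrable_mul_test (hf.memLp_mul h.1) hη.continuous hs)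
    (integrable_mul_test hgrad hη.continuous hs)]
  have hadjoint : ∫ x, f x * g x * η x = ∫ x, g x * (f x * η x) := by
    congr 1; ext x; ring
  rw [hadjoint, h.2 _ (hfc.mul hη) hs.mul_left, ← integral_sub
    (integrable_mul_adjoint_test hψ ha (hfc.mul hη) hs.mul_left v)
    (integrable_mul_test hgrad hη.continuous hs)]
  congr 1; ext x; rw [hleibniz]; ring

end MagneticDeriv

section Tensor

lemma memLp_restrict_comp_fst {E : Type*} [NormedAddCommGroup E] [MeasureSpace E]
    [SFinite (volume : Measure E)] [IsFiniteMeasureOnCompacts (volume : Measure E)] {a : E → ℝ}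
    (ha : ∀ K : Set E, IsCompact K → MemLp a 2 (volume.restrict K)) (K : Set (E × E))
    (hK : IsCompact K) : MemLp (fun z : E × E => a z.1) 2 (volume.restrict K) := by
  have hsub : K ⊆ (Prod.fst '' K) ×ˢ (Prod.snd '' K) := Set.subset_fst_image_prod_snd_image
  have : IsFiniteMeasure (volume.restrict (Prod.snd '' K) : Measure E) :=
    isFiniteMeasure_restrict.2 (hK.image continuous_snd).measure_ne_top
  refine MemLp.mono_measure (Measure.restrict_mono hsub le_rfl) ?_
  rw [Measure.volume_eq_prod, ← Measure.prod_restrict]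
  exact (ha _ (hK.image continuous_fst)).comp_fst _

lemma memLp_two_tensor {α β : Type*} [MeasurableSpace α] [MeasurableSpace β] {μ : Measure α}
    {ν : Measure β} {f : α → ℂ} {g : β → ℂ}
    (hf : MemLp f 2 μ) (hg : MemLp g 2 ν) :
    MemLp (fun z : α × β => f z.1 * g z.2) 2 (μ.prod ν) := by
  have hmeas : AEStronglyMeasurable (fun z : α × β => f z.1 * g z.2) (μ.prod ν) :=
    hf.1.comp_fst.mul hg.1.comp_snd
  rw [memLp_two_iff_integrable_sq_norm hmeas]
  simpa only [Pi.mul_apply, norm_mul, mul_pow] using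
    (hf.integrable_norm_pow two_ne_zero).mul_prod (hg.integrable_norm_pow two_ne_zero)

variable {E : Type*} [NormedAddCommGroup E] [NormedSpace ℝ E] [MeasureSpace E] {v : E} {a : E → ℝ}

lemma HasMagneticDeriv.integral_slice_eq {φ g : E → ℂ} (h : HasMagneticDeriv v a φ g)
    {η : E × E → ℂ} (hη : ContDiff ℝ ∞ η) (hs : HasCompactSupport η) (y : E) :
    ∫ x, g x * η (x, y)
      = ∫ x, φ x * (Complex.I * fderiv ℝ η (x, y) (v, 0) + (a x : ℂ) * η (x, y)) := by
  have hcs : HasCompactSupport fun x => η (x, y) :=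
    hs.comp_isClosedEmbedding (.of_continuous_injective_isClosedMap (by fun_prop)
      (fun x x' hx => (Prod.mk.inj hx).1) (isClosedMap_prodMk_right y))
  refine (h.2 _ (hη.comp (contDiff_prodMk_left y)) hcs).trans ?_
  congr 1; ext x
  have : HasFDerivAt (fun x => η (x, y)) ((fderiv ℝ η (x, y)).comp (.inl ℝ E E)) x :=
    HasFDerivAt.comp (f := fun x => (x, y)) x (hη.differentiable (by simp) (x, y)).hasFDerivAt
      (hasFDerivAt_prodMk_left x y)
  simp [Function.comp_def, this.fderiv]

variable [SFinite (volume : Measure E)]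

lemma HasMagneticDeriv.swap {ψ g : E × E → ℂ}
    (h : HasMagneticDeriv (v, (0 : E)) (fun z : E × E => a z.1) ψ g) :
    HasMagneticDeriv ((0 : E), v) (fun z : E × E => a z.2) (fun z => ψ z.swap)
      (fun z => g z.swap) := by
  have mp : MeasurePreserving (Prod.swap : E × E → E × E) volume volume :=
    Measure.measurePreserving_swap
  have emb : MeasurableEmbedding (Prod.swap : E × E → E × E) :=
    MeasurableEquiv.prodComm.measurableEmbedding
  refine ⟨h.1.comp_measurePreserving mp, fun η hη hs => ?_⟩
  let L : (E × E) ≃L[ℝ] (E × E) := ContinuousLinearEquiv.prodComm ℝ E E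
  have hderiv (z : E × E) : fderiv ℝ (η ∘ L) z (v, 0) = fderiv ℝ η z.swap (0, v) := by
    rw [((hη.differentiable (by simp) (L z)).hasFDerivAt.comp z L.hasFDerivAt).fderiv]
    rfl
  rw [← mp.integral_comp emb, ← mp.integral_comp emb (fun z => ψ z.swap * _)]
  simpa [hderiv, L] using h.2 _ (hη.comp L.contDiff) (hs.comp_homeomorph L.toHomeomorph)

variable [FiniteDimensional ℝ E] [BorelSpace E] [IsFiniteMeasureOnCompacts (volume : Measure E)]

lemma HasMagneticDeriv.tensor
    (ha : ∀ K : Set E, IsCompact K → MemLp a 2 (volume.restrict K)) {φ g χ : E → ℂ}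
    (hφ : MemLp φ 2 volume) (h : HasMagneticDeriv v a φ g) (hχ : MemLp χ 2 volume) :
    HasMagneticDeriv (v, (0 : E)) (fun z : E × E => a z.1) (fun z => φ z.1 * χ z.2)
      (fun z => g z.1 * χ z.2) := by
  have hg : MemLp (fun z : E × E => g z.1 * χ z.2) 2 volume := memLp_two_tensor h.1 hχ
  refine ⟨hg, fun η hη hs => ?_⟩
  have hint := integrable_mul_test hg hη.continuous hs
  have hint' := integrable_mul_adjoint_test (memLp_two_tensor hφ hχ)
    (memLp_restrict_comp_fst ha) hη hs (v, 0)
  rw [Measure.volume_eq_prod] at hint ⊢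
  rw [integral_prod_symm _ hint, integral_prod_symm _ hint']
  congr 1; ext y
  simp only [mul_right_comm _ (χ y), integral_mul_const, h.integral_slice_eq hη hs y]

end Tensor

/-! ### Mollification -/

section Mollifier

open Filter Topology ContinuousLinearMap
open scoped ENNReal

lemma tendsto_eLpNorm_one_sub_of_ae_of_le {α F : Type*} [MeasurableSpace α] {μ : Measure α}
    [NormedAddCommGroup F] {f : ℕ → α → F} {g : α → F} (hf : ∀ k, AEStronglyMeasurable (f k) μ)
    (hg : MemLp g 1 μ) (hle : ∀ k, eLpNorm (f k) 1 μ ≤ eLpNorm g 1 μ)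
    (hlim : ∀ᵐ x ∂μ, Tendsto (fun k => f k x) atTop (𝓝 (g x))) :
    Tendsto (fun k => eLpNorm (f k - g) 1 μ) atTop (𝓝 0) := by
  -- Fatou's lemma for the nonnegative functions `‖f k‖ + ‖g‖ - ‖f k - g‖`.
  have hdiff (k : ℕ) : AEMeasurable (fun x => ‖f k x - g x‖ₑ) μ := ((hf k).sub hg.1).enorm
  have hdiff_ne (k : ℕ) : ∫⁻ x, ‖f k x - g x‖ₑ ∂μ ≠ ⊤ := by
    have := (MemLp.sub ⟨hf k, (hle k).trans_lt hg.2⟩ hg).2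
    rw [eLpNorm_one_eq_lintegral_enorm] at this
    exact this.ne
  have hfatou := lintegral_liminf_le' (μ := μ) (u := atTop)
    (f := fun k x => ‖f k x‖ₑ + ‖g x‖ₑ - ‖f k x - g x‖ₑ) fun k =>
    ((hf k).enorm.add hg.1.enorm).sub (hdiff k)
  have hliminf : ∀ᵐ x ∂μ, liminf (fun k => ‖f k x‖ₑ + ‖g x‖ₑ - ‖f k x - g x‖ₑ) atTop
      = 2 * ‖g x‖ₑ := by
    filter_upwards [hlim] with x hx
    have := ENNReal.Tendsto.sub (hx.enorm.add_const ‖g x‖ₑ) (hx.sub_const (g x)).enorm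
      (.inr (by simp))
    simpa [two_mul] using this.liminf_eq
  have hle' (k : ℕ) : ∫⁻ x, (‖f k x‖ₑ + ‖g x‖ₑ - ‖f k x - g x‖ₑ) ∂μ
      ≤ 2 * eLpNorm g 1 μ - eLpNorm (f k - g) 1 μ := by
    rw [lintegral_sub' (hdiff k) (hdiff_ne k) (.of_forall fun x => enorm_sub_le),
      lintegral_add_left' (hf k).enorm]
    simp only [← eLpNorm_one_eq_lintegral_enorm, two_mul]
    exact tsub_le_tsub_right (add_le_add_left (hle k) _) _
  rw [lintegral_congr_ae hliminf, lintegral_const_mul'' _ hg.1.enorm,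
    ← eLpNorm_one_eq_lintegral_enorm] at hfatou
  have hgap : 2 * eLpNorm g 1 μ
      ≤ liminf (fun k => 2 * eLpNorm g 1 μ - eLpNorm (f k - g) 1 μ) atTop :=
    hfatou.trans (liminf_le_liminf (.of_forall hle'))
  refine ENNReal.tendsto_nhds_zero.2 fun ε hε => ?_
  rcases eq_or_ne (eLpNorm g 1 μ) 0 with h0 | h0
  · refine .of_forall fun k => (eLpNorm_sub_le (hf k) hg.1 le_rfl).trans ?_
    simp [h0, le_antisymm ((hle k).trans_eq h0) bot_le]
  · have hlt : 2 * eLpNorm g 1 μ - ε < 2 * eLpNorm g 1 μ :=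
      ENNReal.sub_lt_self (ENNReal.mul_ne_top (by simp) hg.2.ne) (by simpa using h0) hε.ne'
    filter_upwards [eventually_lt_of_lt_liminf (hlt.trans_le hgap)] with k hk
    exact (lt_of_tsub_lt_tsub_left hk).le

variable {E : Type*} [NormedAddCommGroup E] [NormedSpace ℝ E] [FiniteDimensional ℝ E]
  [MeasureSpace E] {F : Type*} [NormedAddCommGroup F] [NormedSpace ℝ F]

/-- The standard mollifying kernels: smooth probability densities supported in the balls of
radius `2 / (k + 1)` around the origin. -/
noncomputable def mollifier (E : Type*) [NormedAddCommGroup E] [NormedSpace ℝ E]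
    [FiniteDimensional ℝ E] [MeasureSpace E] (k : ℕ) : E → ℝ :=
  ContDiffBump.normed (c := (0 : E)) ⟨1 / (k + 1), 2 / (k + 1), by positivity, by gcongr; norm_num⟩
    volume

/-- Mollification: convolution with the `k`-th mollifying kernel. -/
noncomputable def mollify (k : ℕ) (g : E → F) : E → F :=
  convolution (mollifier E k) g (lsmul ℝ ℝ) volume

lemma mollifier_nonneg (k : ℕ) (x : E) : 0 ≤ mollifier E k x :=
  ContDiffBump.nonneg_normed _ x

lemma contDiff_mollifier (k : ℕ) : ContDiff ℝ ∞ (mollifier E k) :=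
  ContDiffBump.contDiff_normed _

variable [BorelSpace E] [(volume : Measure E).IsAddHaarMeasure]

lemma hasCompactSupport_mollifier (k : ℕ) : HasCompactSupport (mollifier E k) :=
  ContDiffBump.hasCompactSupport_normed _

lemma lintegral_enorm_mollifier (k : ℕ) : ∫⁻ x, ‖mollifier E k x‖ₑ = 1 := by
  simp only [Real.enorm_of_nonneg (mollifier_nonneg k _)]
  rw [← ofReal_integral_eq_lintegral_ofReal ((contDiff_mollifier k).continuous
    |>.integrable_of_hasCompactSupport (hasCompactSupport_mollifier k))
    (.of_forall (mollifier_nonneg k)), mollifier, ContDiffBump.integral_normed, ENNReal.ofReal_one]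

lemma mollify_apply (k : ℕ) (g : E → F) (x : E) :
    mollify k g x = ∫ y, mollifier E k (x - y) • g y := by
  rw [mollify, convolution_eq_swap]
  rfl

lemma contDiff_mollify (k : ℕ) {g : E → F} (hg : LocallyIntegrable g volume) :
    ContDiff ℝ ∞ (mollify k g) :=
  (hasCompactSupport_mollifier k).contDiff_convolution_left (n := ⊤) _ (contDiff_mollifier k) hg

lemma hasCompactSupport_mollify (k : ℕ) {g : E → F} (hg : HasCompactSupport g) :
    HasCompactSupport (mollify k g) :=
  (hasCompactSupport_mollifier k).convolution _ hg

lemma fderiv_mollify_apply (k : ℕ) {g : E → F} (hg : LocallyIntegrable g volume) (x v : E) :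
    fderiv ℝ (mollify k g) x v = ∫ y, fderiv ℝ (mollifier E k) (x - y) v • g y := by
  have hint := ((hasCompactSupport_mollifier (E := E) k).fderiv ℝ).convolutionExists_left
    (μ := volume) (precompL E (lsmul ℝ ℝ : ℝ →L[ℝ] F →L[ℝ] F))
    ((contDiff_mollifier k).continuous_fderiv (by simp)) hg x
  have hderiv := (hasCompactSupport_mollifier (E := E) k).hasFDerivAt_convolution_left (lsmul ℝ ℝ)
    ((contDiff_mollifier k).of_le (by simp)) hg x
  rw [mollify, hderiv.fderiv, convolution_eq_swap,
    ContinuousLinearMap.integral_apply hint.integrable_swap]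
  simp [precompL_apply]

lemma enorm_mollify_rpow_le (k : ℕ) {p : ℝ} (hp : 1 ≤ p) {g : E → F}
    (hg : AEStronglyMeasurable g volume) (x : E) :
    ‖mollify k g x‖ₑ ^ p ≤ ∫⁻ y, ‖mollifier E k (x - y)‖ₑ * ‖g y‖ₑ ^ p := by
  have hp0 : 0 < p := zero_lt_one.trans_le hp
  have hmeas : Measurable fun y : E => ‖mollifier E k (x - y)‖ₑ :=
    ((contDiff_mollifier k).continuous.measurable.comp (measurable_const.sub measurable_id)).enorm
  let ν : Measure E := volume.withDensity fun y => ‖mollifier E k (x - y)‖ₑ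
  have hν : IsProbabilityMeasure ν := ⟨by
    rw [withDensity_apply _ .univ, Measure.restrict_univ,
      lintegral_sub_left_eq_self (fun y : E => ‖mollifier E k y‖ₑ) x, lintegral_enorm_mollifier]⟩
  have hle : ‖mollify k g x‖ₑ ≤ eLpNorm' g 1 ν := by
    rw [mollify_apply, eLpNorm', lintegral_withDensity_eq_lintegral_mul₀ hmeas.aemeasurable
      (hg.enorm.pow_const _)]
    simpa [enorm_smul] using enorm_integral_le_lintegral_enorm (μ := volume)
      fun y => mollifier E k (x - y) • g y
  have hjensen : eLpNorm' g 1 ν ≤ eLpNorm' g p ν :=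
    eLpNorm'_le_eLpNorm'_of_exponent_le one_pos hp ν
      (hg.mono_ac (withDensity_absolutelyContinuous _ _))
  refine (ENNReal.rpow_le_rpow (hle.trans hjensen) hp0.le).trans_eq ?_
  rw [eLpNorm', ← ENNReal.rpow_mul, one_div, inv_mul_cancel₀ hp0.ne', ENNReal.rpow_one,
    lintegral_withDensity_eq_lintegral_mul₀ hmeas.aemeasurable (hg.enorm.pow_const p)]
  rfl

lemma eLpNorm_mollify_le (k : ℕ) {p : ℝ≥0∞} (hp : 1 ≤ p) (hp' : p ≠ ⊤) {g : E → F}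
    (hg : AEStronglyMeasurable g volume) :
    eLpNorm (mollify k g) p volume ≤ eLpNorm g p volume := by
  have hp0 : p ≠ 0 := (zero_lt_one.trans_le hp).ne'
  have hp1 : 1 ≤ p.toReal := (ENNReal.toReal_mono hp' hp).trans_eq' rfl
  have hmeas : Measurable fun x : E => ‖mollifier E k x‖ₑ :=
    (contDiff_mollifier k).continuous.measurable.enorm
  have hmeas' (y : E) : Measurable fun x : E => ‖mollifier E k (x - y)‖ₑ :=
    hmeas.comp (measurable_id.sub measurable_const)
  rw [eLpNorm_eq_lintegral_rpow_enorm_toReal hp0 hp',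
    eLpNorm_eq_lintegral_rpow_enorm_toReal hp0 hp']
  gcongr ?_ ^ _
  calc ∫⁻ x, ‖mollify k g x‖ₑ ^ p.toReal
      ≤ ∫⁻ x, ∫⁻ y, ‖mollifier E k (x - y)‖ₑ * ‖g y‖ₑ ^ p.toReal :=
        lintegral_mono (enorm_mollify_rpow_le k hp1 hg)
    _ = ∫⁻ y, ∫⁻ x, ‖mollifier E k (x - y)‖ₑ * ‖g y‖ₑ ^ p.toReal :=
        lintegral_lintegral_swap ((hmeas.comp (measurable_fst.sub measurable_snd)).aemeasurable.mul
          (hg.comp_snd.enorm.pow_const _))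
    _ = ∫⁻ y, ‖g y‖ₑ ^ p.toReal := by
        congr 1; ext y
        rw [lintegral_mul_const _ (hmeas' y),
          lintegral_sub_right_eq_self (fun x : E => ‖mollifier E k x‖ₑ) y,
          lintegral_enorm_mollifier, one_mul]

variable [CompleteSpace F]

lemma ae_tendsto_mollify {g : E → F} (hg : LocallyIntegrable g volume) :
    ∀ᵐ x, Tendsto (fun k => mollify k g x) atTop (𝓝 (g x)) := by
  refine ContDiffBump.ae_convolution_tendsto_right_of_locallyIntegrable (K := 2) ?_
    (.of_forall fun k => ?_) hg
  · simpa [div_eq_mul_inv] using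
      (tendsto_one_div_add_atTop_nhds_zero_nat (𝕜 := ℝ)).const_mul 2
  · exact le_of_eq (by simp only; ring)

lemma tendsto_eLpNorm_one_mollify_sub {g : E → F} (hg : Integrable g volume) :
    Tendsto (fun k => eLpNorm (mollify k g - g) 1 volume) atTop (𝓝 0) :=
  tendsto_eLpNorm_one_sub_of_ae_of_le
    (fun k => (contDiff_mollify k hg.locallyIntegrable).continuous.aestronglyMeasurable)
    (memLp_one_iff_integrable.2 hg) (fun k => eLpNorm_mollify_le k le_rfl (by simp) hg.1)
    (ae_tendsto_mollify hg.locallyIntegrable)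

end Mollifier

/-! ### Weak derivatives -/

section WeakDerivative

open Filter Topology

lemma tendsto_eLpNorm_one_clm_apply_sub {α F F' : Type*} [MeasurableSpace α] {μ : Measure α}
    [NormedAddCommGroup F] [NormedSpace ℝ F] [NormedAddCommGroup F'] [NormedSpace ℝ F']
    {L : ℕ → α → F →L[ℝ] F'} {L₀ : α → F →L[ℝ] F'} {G : ℕ → α → F} {G₀ : α → F} {C : ℝ}
    (hL : ∀ k, AEStronglyMeasurable (L k) μ) (hL₀ : AEStronglyMeasurable L₀ μ)
    (hC : ∀ k x, ‖L k x‖ ≤ C) (hC₀ : ∀ x, ‖L₀ x‖ ≤ C)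
    (hlim : ∀ᵐ x ∂μ, Tendsto (fun k => L k x) atTop (𝓝 (L₀ x)))
    (hG : ∀ k, AEStronglyMeasurable (G k) μ) (hG₀ : Integrable G₀ μ)
    (hGlim : Tendsto (fun k => eLpNorm (G k - G₀) 1 μ) atTop (𝓝 0)) :
    Tendsto (fun k => eLpNorm (fun x => L k x (G k x) - L₀ x (G₀ x)) 1 μ) atTop (𝓝 0) := by
  have hmeas {M : α → F →L[ℝ] F'} {H : α → F} (hM : AEStronglyMeasurable M μ)
      (hH : AEStronglyMeasurable H μ) : AEStronglyMeasurable (fun x => M x (H x)) μ :=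
    isBoundedBilinearMap_apply.continuous.comp_aestronglyMeasurable (hM.prodMk hH)
  have hfst : Tendsto (fun k => eLpNorm (fun x => L k x ((G k - G₀) x)) 1 μ) atTop (𝓝 0) := by
    have := ENNReal.Tendsto.const_mul (a := ENNReal.ofReal C) hGlim (.inr ENNReal.ofReal_ne_top)
    rw [mul_zero] at this
    exact tendsto_of_tendsto_of_tendsto_of_le_of_le tendsto_const_nhds this (fun k => zero_le)
      fun k => eLpNorm_le_mul_eLpNorm_of_ae_le_mul
        (.of_forall fun x => (L k x).le_of_opNorm_le (hC k x) _) 1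
  have hsnd : Tendsto (fun k => eLpNorm (fun x => (L k x - L₀ x) (G₀ x)) 1 μ) atTop (𝓝 0) := by
    simp only [eLpNorm_one_eq_lintegral_enorm]
    rw [← lintegral_zero (μ := μ)]
    refine tendsto_lintegral_of_dominated_convergence' (fun x => ENNReal.ofReal (C + C) * ‖G₀ x‖ₑ)
      (fun k => (hmeas ((hL k).sub hL₀) hG₀.1).enorm) (fun k => .of_forall fun x => ?_) ?_ ?_
    · beta_reduce
      rw [← ofReal_norm, ← ofReal_norm, ← ENNReal.ofReal_mul' (norm_nonneg _)]
      exact ENNReal.ofReal_le_ofReal ((L k x - L₀ x).le_of_opNorm_le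
        ((norm_sub_le _ _).trans (add_le_add (hC k x) (hC₀ x))) _)
    · rw [lintegral_const_mul' _ _ ENNReal.ofReal_ne_top]
      exact ENNReal.mul_ne_top ENNReal.ofReal_ne_top hG₀.2.ne
    · filter_upwards [hlim] with x hx
      simpa using (((ContinuousLinearMap.apply ℝ F' (G₀ x)).continuous.tendsto _).comp
        (hx.sub_const (L₀ x))).enorm
  have hadd := hfst.add hsnd
  rw [add_zero] at hadd
  refine tendsto_of_tendsto_of_tendsto_of_le_of_le tendsto_const_nhds hadd (fun k => zero_le)
    fun k => ?_
  refine (le_of_eq ?_).trans (eLpNorm_add_le (hmeas (hL k) ((hG k).sub hG₀.1))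
    (hmeas ((hL k).sub hL₀) hG₀.1) le_rfl)
  congr 1; ext x; simp

variable {E : Type*} [NormedAddCommGroup E] [MeasureSpace E]
  {F : Type*} [NormedAddCommGroup F] [NormedSpace ℝ F]

lemma tendsto_integral_smul_of_eLpNorm_one [BorelSpace E] {η : E → ℝ} (hη : Continuous η)
    (hs : HasCompactSupport η) {f : ℕ → E → F} {g : E → F}
    (hf : ∀ k, LocallyIntegrable (f k) volume) (hg : LocallyIntegrable g volume)
    (hlim : Tendsto (fun k => eLpNorm (f k - g) 1 volume) atTop (𝓝 0)) :
    Tendsto (fun k => ∫ x, η x • f k x) atTop (𝓝 (∫ x, η x • g x)) := by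
  obtain ⟨C, hC⟩ := hη.bounded_above_of_compact_support hs
  refine tendsto_integral_of_L1 _ (hg.integrable_smul_left_of_hasCompactSupport hη hs).1
    (.of_forall fun k => (hf k).integrable_smul_left_of_hasCompactSupport hη hs) ?_
  have := ENNReal.Tendsto.const_mul (a := ENNReal.ofReal C) hlim (.inr ENNReal.ofReal_ne_top)
  rw [mul_zero] at this
  refine tendsto_of_tendsto_of_tendsto_of_le_of_le tendsto_const_nhds this (fun k => zero_le)
    fun k => ?_
  simp only [← eLpNorm_one_eq_lintegral_enorm, ← smul_sub]
  refine eLpNorm_le_mul_eLpNorm_of_ae_le_mul (.of_forall fun x => ?_) 1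
  rw [norm_smul]
  exact mul_le_mul_of_nonneg_right (hC x) (norm_nonneg _)

variable [NormedSpace ℝ E] {v : E} {f G : E → F}

/-- `G` is the weak derivative of `f` in the direction `v`, tested against real functions. -/
def IsWeakDeriv (v : E) (f G : E → F) : Prop :=
  ∀ η : E → ℝ, ContDiff ℝ ∞ η → HasCompactSupport η →
    ∫ x, fderiv ℝ η x v • f x = -∫ x, η x • G x

variable [BorelSpace E]

lemma IsWeakDeriv.of_tendsto {f' G' : ℕ → E → F} (h : ∀ k, IsWeakDeriv v (f' k) (G' k))
    (hf' : ∀ k, LocallyIntegrable (f' k) volume) (hG' : ∀ k, LocallyIntegrable (G' k) volume)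
    (hf : LocallyIntegrable f volume) (hG : LocallyIntegrable G volume)
    (hflim : Tendsto (fun k => eLpNorm (f' k - f) 1 volume) atTop (𝓝 0))
    (hGlim : Tendsto (fun k => eLpNorm (G' k - G) 1 volume) atTop (𝓝 0)) :
    IsWeakDeriv v f G := by
  intro η hη hs
  have hleft := tendsto_integral_smul_of_eLpNorm_one (continuous_fderiv_apply hη v)
    (hs.fderiv_apply (𝕜 := ℝ) v) hf' hf hflim
  have hright := tendsto_integral_smul_of_eLpNorm_one hη.continuous hs hG' hG hGlim
  simp only [h _ η hη hs] at hleft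
  exact tendsto_nhds_unique hleft hright.neg

variable [FiniteDimensional ℝ E] [(volume : Measure E).IsAddHaarMeasure]

lemma isWeakDeriv_fderiv (hf : ContDiff ℝ ∞ f) (v : E) :
    IsWeakDeriv v f fun x => fderiv ℝ f x v := by
  intro η hη hs
  have hint {ζ : E → ℝ} {g : E → F} (hζ : Continuous ζ) (hζs : HasCompactSupport ζ)
      (hg : Continuous g) : Integrable (fun x => ζ x • g x) volume :=
    (hζ.smul hg).integrable_of_hasCompactSupport hζs.smul_right
  rw [integral_smul_fderiv_eq_neg_fderiv_smul_of_integrable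
    (hint (continuous_fderiv_apply hη v) (hs.fderiv_apply (𝕜 := ℝ) v) hf.continuous)
    (hint hη.continuous hs (continuous_fderiv_apply hf v))
    (hint hη.continuous hs hf.continuous)
    (fun x _ => hη.differentiable (by simp) x) (fun x _ => hf.differentiable (by simp) x), neg_neg]

lemma IsWeakDeriv.fderiv_mollify (h : IsWeakDeriv v f G) (hf : LocallyIntegrable f volume) (k : ℕ)
    (x : E) : fderiv ℝ (mollify k f) x v = mollify k G x := by
  have hη : ContDiff ℝ ∞ fun y => mollifier E k (x - y) :=
    (contDiff_mollifier k).comp (contDiff_const.sub contDiff_id)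
  have hs : HasCompactSupport fun y => mollifier E k (x - y) :=
    (hasCompactSupport_mollifier k).comp_homeomorph (Homeomorph.subLeft x)
  have hderiv (y : E) : fderiv ℝ (fun y => mollifier E k (x - y)) y v
      = -(fderiv ℝ (mollifier E k) (x - y) v) := by
    have hcomp : HasFDerivAt (fun y => mollifier E k (x - y)) _ y :=
      ((contDiff_mollifier k).differentiable (by simp) (x - y)).hasFDerivAt.comp y
        ((hasFDerivAt_id y).const_sub x)
    simp [hcomp.fderiv]
  have hweak := h _ hη hs
  simp only [hderiv, neg_smul, integral_neg, neg_inj] at hweak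
  rw [fderiv_mollify_apply k hf, hweak, mollify_apply]

variable [CompleteSpace F] {F' : Type*} [NormedAddCommGroup F'] [NormedSpace ℝ F']

lemma IsWeakDeriv.comp (h : IsWeakDeriv v f G) (hf : Integrable f volume)
    (hG : Integrable G volume) {Θ : F → F'} (hΘ : ContDiff ℝ ∞ Θ) {C : ℝ}
    (hC : ∀ z, ‖fderiv ℝ Θ z‖ ≤ C) :
    IsWeakDeriv v (fun x => Θ (f x)) fun x => fderiv ℝ Θ (f x) (G x) := by
  have hlip (z w : F) : ‖Θ z - Θ w‖ ≤ C * ‖z - w‖ :=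
    convex_univ.norm_image_sub_le_of_norm_fderiv_le
      (fun z _ => hΘ.differentiable (by simp) z) (fun z _ => hC z) trivial trivial
  have hΘ' : Continuous (fderiv ℝ Θ) := hΘ.continuous_fderiv (by simp)
  have hfk (k : ℕ) : ContDiff ℝ ∞ (mollify k f) := contDiff_mollify k hf.locallyIntegrable
  have hGk (k : ℕ) : ContDiff ℝ ∞ (mollify k G) := contDiff_mollify k hG.locallyIntegrable
  have hweak (k : ℕ) : IsWeakDeriv v (fun x => Θ (mollify k f x))
      fun x => fderiv ℝ Θ (mollify k f x) (mollify k G x) := by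
    have hchain (x : E) : fderiv ℝ (fun x => Θ (mollify k f x)) x v
        = fderiv ℝ Θ (mollify k f x) (mollify k G x) := by
      rw [fderiv_fun_comp x (hΘ.differentiable (by simp) _) ((hfk k).differentiable (by simp) x),
        ContinuousLinearMap.comp_apply, h.fderiv_mollify hf.locallyIntegrable]
    simpa only [hchain, Function.comp_def] using isWeakDeriv_fderiv (hΘ.comp (hfk k)) v
  have hmeas : AEStronglyMeasurable (fun x => fderiv ℝ Θ (f x)) volume :=
    hΘ'.comp_aestronglyMeasurable hf.1
  have hΘf : LocallyIntegrable (fun x => Θ (f x)) volume := by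
    have : Integrable (fun x => Θ (f x) - Θ 0) volume :=
      (hf.norm.const_mul C).mono' ((hΘ.continuous.comp_aestronglyMeasurable hf.1).sub
        aestronglyMeasurable_const) (.of_forall fun x => by simpa using hlip (f x) 0)
    simpa [Pi.add_def] using this.locallyIntegrable.add (locallyIntegrable_const (Θ 0))
  have hΘG : Integrable (fun x => fderiv ℝ Θ (f x) (G x)) volume :=
    (hG.norm.const_mul C).mono' (isBoundedBilinearMap_apply.continuous.comp_aestronglyMeasurable
      (hmeas.prodMk hG.1)) (.of_forall fun x => (fderiv ℝ Θ (f x)).le_of_opNorm_le (hC _) _)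
  refine .of_tendsto hweak
    (fun k => (hΘ.continuous.comp (hfk k).continuous).locallyIntegrable)
    (fun k => ((hΘ'.comp (hfk k).continuous).clm_apply (hGk k).continuous).locallyIntegrable)
    hΘf hΘG.locallyIntegrable ?_ ?_
  · have := ENNReal.Tendsto.const_mul (a := ENNReal.ofReal C) (tendsto_eLpNorm_one_mollify_sub hf)
      (.inr ENNReal.ofReal_ne_top)
    rw [mul_zero] at this
    exact tendsto_of_tendsto_of_tendsto_of_le_of_le tendsto_const_nhds this (fun k => zero_le)
      fun k => eLpNorm_le_mul_eLpNorm_of_ae_le_mul (.of_forall fun x => hlip _ _) 1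
  · refine tendsto_eLpNorm_one_clm_apply_sub
      (fun k => (hΘ'.comp (hfk k).continuous).aestronglyMeasurable) hmeas (fun k x => hC _)
      (fun x => hC _) ?_ (fun k => (hGk k).continuous.aestronglyMeasurable) hG
      (tendsto_eLpNorm_one_mollify_sub hG)
    filter_upwards [ae_tendsto_mollify hf.locallyIntegrable] with x hx
    exact (hΘ'.tendsto _).comp hx

end WeakDerivative

/-! ### The diamagnetic Sobolev inequality -/

section RegNorm

variable {F : Type*} [NormedAddCommGroup F] {κ : ℝ}

/-- A smooth approximation of the norm, vanishing at the origin. -/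
noncomputable def regNorm (κ : ℝ) (z : F) : ℝ := √(‖z‖ ^ 2 + κ ^ 2) - κ

lemma regNorm_zero (hκ : 0 ≤ κ) : regNorm κ (0 : F) = 0 := by
  simp [regNorm, Real.sqrt_sq hκ]

lemma abs_regNorm_le (hκ : 0 ≤ κ) (z : F) : |regNorm κ z| ≤ ‖z‖ := by
  rw [regNorm, abs_of_nonneg (sub_nonneg.2 (Real.le_sqrt_of_sq_le (by nlinarith [norm_nonneg z]))),
    sub_le_iff_le_add, Real.sqrt_le_left (by positivity)]
  nlinarith [norm_nonneg z]

variable [InnerProductSpace ℝ F]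

lemma contDiff_regNorm (hκ : 0 < κ) : ContDiff ℝ ∞ (regNorm κ : F → ℝ) :=
  (((contDiff_norm_sq ℝ).add contDiff_const).sqrt fun z => by positivity).sub contDiff_const

lemma fderiv_regNorm_apply (hκ : 0 < κ) (z w : F) :
    fderiv ℝ (regNorm κ) z w = inner ℝ z w / √(‖z‖ ^ 2 + κ ^ 2) := by
  have h : HasFDerivAt (regNorm κ : F → ℝ) _ z :=
    (((hasFDerivAt_id z).norm_sq.add_const (κ ^ 2)).sqrt (by positivity)).sub_const κ
  rw [h.fderiv]
  simp
  ring

lemma norm_fderiv_regNorm_le (hκ : 0 < κ) (z : F) :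
    ‖fderiv ℝ (regNorm κ) z‖ ≤ 1 := by
  refine ContinuousLinearMap.opNorm_le_bound _ zero_le_one fun w => ?_
  have hz : ‖z‖ ≤ √(‖z‖ ^ 2 + κ ^ 2) := Real.le_sqrt_of_sq_le (by nlinarith)
  rw [fderiv_regNorm_apply hκ, one_mul, norm_div, Real.norm_of_nonneg (Real.sqrt_nonneg _)]
  exact div_le_of_le_mul₀ (Real.sqrt_nonneg _) (norm_nonneg w) (((norm_inner_le_norm z w).trans_eq
    (mul_comm _ _)).trans (mul_le_mul_of_nonneg_left hz (norm_nonneg w)))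

end RegNorm

section Sobolev

open Filter Topology

lemma integrable_mul_of_hasCompactSupport {E : Type*} [TopologicalSpace E] [MeasureSpace E]
    {a f : E → ℂ}
    (ha : ∀ K : Set E, IsCompact K → MemLp a 2 (volume.restrict K))
    (hf : MemLp f 2 volume) (hs : HasCompactSupport f) :
    Integrable (fun x => a x * f x) volume := by
  rw [← integrableOn_iff_integrable_of_support_subset
    ((Function.support_mul_subset_right a f).trans (subset_tsupport f))]
  exact (ha _ hs.isCompact).integrable_mul (hf.restrict (tsupport f))

lemma HasMagneticDeriv.isWeakDeriv {E : Type*} [NormedAddCommGroup E] [NormedSpace ℝ E]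
    [MeasureSpace E] [BorelSpace E] [IsFiniteMeasureOnCompacts (volume : Measure E)]
    {v : E} {a : E → ℝ} {f g : E → ℂ}
    (ha : ∀ K : Set E, IsCompact K → MemLp a 2 (volume.restrict K))
    (hf : MemLp f 2 volume) (h : HasMagneticDeriv v a f g) :
    IsWeakDeriv v f (fun x => Complex.I * (g x - a x * f x)) := by
  intro η hη hsη
  let ηc : E → ℂ := fun x => η x
  have hηc : ContDiff ℝ ∞ ηc := Complex.ofRealCLM.contDiff.comp hη
  have hs : HasCompactSupport ηc := hsη.comp_left (g := Complex.ofReal) rfl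
  have hderiv (x : E) : fderiv ℝ ηc x v = (fderiv ℝ η x v : ℝ) := by
    have : HasFDerivAt ηc (Complex.ofRealCLM.comp (fderiv ℝ η x)) x :=
      Complex.ofRealCLM.hasFDerivAt.comp x (hη.differentiable (by simp) x).hasFDerivAt
    simp [this.fderiv]
  have hint := integrable_mul_test h.1 hηc.continuous hs
  have hint' := integrable_mul_adjoint_test hf ha hηc hs v
  have hpot : Integrable (fun x => f x * (a x * ηc x)) volume :=
    hf.integrable_mul (memLp_mul_of_hasCompactSupport ha hηc.continuous hs)
  calc ∫ x, fderiv ℝ η x v • f x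
      = -Complex.I *
          ∫ x, f x * (Complex.I * fderiv ℝ ηc x v + a x * ηc x) - f x * (a x * ηc x) := by
        rw [← integral_const_mul]
        congr 1; ext x; simp only [Complex.real_smul, hderiv]
        linear_combination (((fderiv ℝ η x v : ℝ) : ℂ) * f x) * Complex.I_sq
    _ = -Complex.I * ∫ x, g x * ηc x - f x * (a x * ηc x) := by
        rw [integral_sub hint' hpot, ← h.2 _ hηc hs, integral_sub hint hpot]
    _ = -∫ x, η x • (Complex.I * (g x - a x * f x)) := by
        rw [neg_mul, ← integral_const_mul]
        congr 2; ext x; simp only [Complex.real_smul, ηc]; ring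

lemma opNorm_le_sum_basis {F : Type*} [NormedAddCommGroup F] [NormedSpace ℝ F] (L : R3 →L[ℝ] F) :
    ‖L‖ ≤ ∑ j, ‖L (e j)‖ := by
  refine L.opNorm_le_bound (by positivity) fun x => ?_
  have hx : x = ∑ j, x j • e j := by
    ext i
    simp [e, Finset.sum_apply, Pi.single_apply]
  calc ‖L x‖ = ‖∑ j, x j • L (e j)‖ := by
        conv_lhs => rw [hx, map_sum]
        simp only [map_smul]
    _ ≤ ∑ j, ‖x j‖ * ‖L (e j)‖ := (norm_sum_le _ _).trans_eq (by simp only [norm_smul])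
    _ ≤ ∑ j, ‖L (e j)‖ * ‖x‖ := by
        refine Finset.sum_le_sum fun j _ => ?_
        rw [mul_comm]
        exact mul_le_mul_of_nonneg_left (PiLp.norm_apply_le x j) (norm_nonneg _)
    _ = (∑ j, ‖L (e j)‖) * ‖x‖ := (Finset.sum_mul _ _ _).symm

/-- The Gagliardo–Nirenberg–Sobolev constant for the embedding of `H¹(ℝ³)` into `L⁶(ℝ³)`. -/
noncomputable def gnsConst : ℝ≥0 := eLpNormLESNormFDerivOfEqInnerConst (volume : Measure R3) 2

lemma eLpNorm_two_fderiv_mollify_le {u : R3 → ℝ} (hu : LocallyIntegrable u volume)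
    {w : Fin 3 → R3 → ℝ} (hw : ∀ j, MemLp (w j) 2 volume) (h : ∀ j, IsWeakDeriv (e j) u (w j))
    (k : ℕ) : eLpNorm (fderiv ℝ (mollify k u)) 2 volume ≤ ∑ j, eLpNorm (w j) 2 volume := by
  have hmeas (j : Fin 3) : AEStronglyMeasurable (fun x => ‖mollify k (w j) x‖) volume :=
    (contDiff_mollify k ((hw j).locallyIntegrable (by norm_num))).continuous.norm
      |>.aestronglyMeasurable
  calc eLpNorm (fderiv ℝ (mollify k u)) 2 volume
      ≤ eLpNorm (∑ j, fun x => ‖mollify k (w j) x‖) 2 volume :=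
        eLpNorm_mono_real fun x => (opNorm_le_sum_basis _).trans_eq <| by
          simp only [Finset.sum_apply, (h _).fderiv_mollify hu]
    _ ≤ ∑ j, eLpNorm (mollify k (w j)) 2 volume := by
        simpa only [eLpNorm_norm] using eLpNorm_sum_le (fun j _ => hmeas j) (by norm_num)
    _ ≤ ∑ j, eLpNorm (w j) 2 volume :=
        Finset.sum_le_sum fun j _ => eLpNorm_mollify_le k (by norm_num) (by simp) (hw j).1

lemma eLpNorm_six_le_of_isWeakDeriv {u : R3 → ℝ} (hu : LocallyIntegrable u volume)
    (hs : HasCompactSupport u) {w : Fin 3 → R3 → ℝ} (hw : ∀ j, MemLp (w j) 2 volume)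
    (h : ∀ j, IsWeakDeriv (e j) u (w j)) :
    eLpNorm u 6 volume ≤ gnsConst * ∑ j, eLpNorm (w j) 2 volume := by
  have hk (k : ℕ) := contDiff_mollify k hu
  have hbound (k : ℕ) : eLpNorm (mollify k u) 6 volume
      ≤ gnsConst * ∑ j, eLpNorm (w j) 2 volume :=
    (eLpNorm_le_eLpNorm_fderiv_of_eq_inner (volume : Measure R3) (p := 2) (p' := 6)
      ((hk k).of_le (by simp)) (hasCompactSupport_mollify k hs)
      (by norm_num) (by simp) (by simp; norm_num)).trans
    (mul_le_mul_right (eLpNorm_two_fderiv_mollify_le hu hw h k) _)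
  calc eLpNorm u 6 volume
      ≤ liminf (fun k => eLpNorm (mollify k u) 6 volume) atTop :=
        Lp.eLpNorm_lim_le_liminf_eLpNorm (fun k => (hk k).continuous.aestronglyMeasurable) u
          (ae_tendsto_mollify hu)
    _ ≤ liminf (fun _ : ℕ => gnsConst * ∑ j, eLpNorm (w j) 2 volume) atTop :=
        liminf_le_liminf (.of_forall hbound)
    _ = gnsConst * ∑ j, eLpNorm (w j) 2 volume := liminf_const _

-- The vector potential drops out of the derivative of `|f|`, since `⟨z, i a z⟩ = 0` for real `a`.
lemma norm_fderiv_regNorm_magnetic_le {κ : ℝ} (hκ : 0 < κ) (z w : ℂ) (a : ℝ) :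
    ‖fderiv ℝ (regNorm κ) z (Complex.I * (w - a * z))‖ ≤ ‖w‖ := by
  have hperp : inner ℝ z (Complex.I * (w - a * z)) = inner ℝ z (Complex.I * w) := by
    simp only [Complex.inner, Complex.mul_re, Complex.conj_re, Complex.conj_im, Complex.I_re,
      Complex.I_im, Complex.sub_re, Complex.sub_im, Complex.mul_im, Complex.ofReal_re,
      Complex.ofReal_im]
    ring
  rw [fderiv_regNorm_apply hκ, hperp, ← fderiv_regNorm_apply hκ]
  simpa using (fderiv ℝ (regNorm κ) z).le_of_opNorm_le (norm_fderiv_regNorm_le hκ z)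
    (Complex.I * w)

variable {A : R3 → R3} {f : R3 → ℂ} {g : Fin 3 → R3 → ℂ}

lemma eLpNorm_six_regNorm_le (hA : ∀ j : Fin 3, L2Loc (fun x => A x j))
    (hf : MemLp f 2 volume) (hs : HasCompactSupport f) (hgs : ∀ j, HasCompactSupport (g j))
    (h : ∀ j, HasMagneticDeriv (e j) (fun x => A x j) f (g j)) {κ : ℝ} (hκ : 0 < κ) :
    eLpNorm (fun x => regNorm κ (f x)) 6 volume ≤ gnsConst * ∑ j, eLpNorm (g j) 2 volume := by
  have hint {f : R3 → ℂ} (hf : MemLp f 2 volume) (hs : HasCompactSupport f) :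
      Integrable f volume :=
    memLp_one_iff_integrable.1 (hf.mono_exponent_of_measure_support_ne_top
      (fun x => image_eq_zero_of_notMem_tsupport) hs.isCompact.measure_ne_top (by norm_num))
  have hG (j : Fin 3) : Integrable (fun x => Complex.I * (g j x - (A x j : ℝ) * f x)) volume :=
    ((hint (h j).1 (hgs j)).sub (integrable_mul_of_hasCompactSupport
      (fun K hK => (hA j K hK).ofReal) hf hs)).const_mul _
  have hΘ : ContDiff ℝ ∞ (regNorm κ : ℂ → ℝ) := contDiff_regNorm hκ
  have hle (j : Fin 3) (x : R3) := norm_fderiv_regNorm_magnetic_le hκ (f x) (g j x) (A x j)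
  have hw (j : Fin 3) : MemLp (fun x => fderiv ℝ (regNorm κ) (f x)
      (Complex.I * (g j x - (A x j : ℝ) * f x))) 2 volume :=
    (h j).1.of_le (isBoundedBilinearMap_apply.continuous.comp_aestronglyMeasurable
      (((hΘ.continuous_fderiv (by simp)).comp_aestronglyMeasurable hf.1).prodMk (hG j).1))
      (.of_forall (hle j))
  have hu : Integrable (fun x => regNorm κ (f x)) volume :=
    (hint hf hs).mono (hΘ.continuous.comp_aestronglyMeasurable hf.1)
      (.of_forall fun x => abs_regNorm_le hκ.le _)
  refine (eLpNorm_six_le_of_isWeakDeriv hu.locallyIntegrable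
    (hs.comp_left (g := regNorm κ) (regNorm_zero hκ.le)) hw fun j =>
    ((h j).isWeakDeriv (hA j) hf).comp (hint hf hs) (hG j) hΘ (norm_fderiv_regNorm_le hκ)).trans ?_
  gcongr with j
  exact eLpNorm_mono (hle j)

lemma eLpNorm_six_le_of_hasMagneticDeriv (hA : ∀ j : Fin 3, L2Loc (fun x => A x j))
    (hf : MemLp f 2 volume) (hs : HasCompactSupport f) (hgs : ∀ j, HasCompactSupport (g j))
    (h : ∀ j, HasMagneticDeriv (e j) (fun x => A x j) f (g j)) :
    eLpNorm f 6 volume ≤ gnsConst * ∑ j, eLpNorm (g j) 2 volume := by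
  have hlim (x : R3) : Tendsto (fun k : ℕ => regNorm (1 / ((k : ℝ) + 1)) (f x)) atTop
      (𝓝 ‖f x‖) := by
    have hcont : Continuous fun κ : ℝ => regNorm κ (f x) := by unfold regNorm; fun_prop
    simpa [regNorm, Function.comp_def] using
      (hcont.tendsto 0).comp (tendsto_one_div_add_atTop_nhds_zero_nat (𝕜 := ℝ))
  rw [← eLpNorm_norm f]
  calc eLpNorm (fun x => ‖f x‖) 6 volume
      ≤ liminf (fun k : ℕ => eLpNorm (fun x => regNorm (1 / ((k : ℝ) + 1)) (f x)) 6 volume) atTop :=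
        Lp.eLpNorm_lim_le_liminf_eLpNorm
          (fun k => (contDiff_regNorm (by positivity)).continuous.comp_aestronglyMeasurable hf.1) _
          (.of_forall hlim)
    _ ≤ liminf (fun _ : ℕ => gnsConst * ∑ j, eLpNorm (g j) 2 volume) atTop :=
        liminf_le_liminf (.of_forall fun k =>
          eLpNorm_six_regNorm_le hA hf hs hgs h (by positivity))
    _ = gnsConst * ∑ j, eLpNorm (g j) 2 volume := liminf_const _

end Sobolev

/-! ### Form bounds for uniformly local `L²` potentials -/

section FormBound

open Metric
open scoped ENNReal

lemma lintegral_lintegral_ball {E : Type*} [NormedAddCommGroup E] [NormedSpace ℝ E]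
    [FiniteDimensional ℝ E] [MeasurableSpace E] [BorelSpace E] (μ : Measure E) [μ.IsAddHaarMeasure]
    {F : E → ℝ≥0∞} (hF : AEMeasurable F μ) (r : ℝ) :
    ∫⁻ z, ∫⁻ x in ball z r, F x ∂μ ∂μ = μ (ball 0 r) * ∫⁻ x, F x ∂μ := by
  have hmeas : MeasurableSet {p : E × E | p.2 ∈ ball p.1 r} :=
    measurableSet_lt (measurable_snd.dist measurable_fst) measurable_const
  calc ∫⁻ z, ∫⁻ x in ball z r, F x ∂μ ∂μ
      = ∫⁻ z, ∫⁻ x, {p : E × E | p.2 ∈ ball p.1 r}.indicator (fun p => F p.2) (z, x) ∂μ ∂μ := by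
        congr 1; ext z
        rw [← lintegral_indicator measurableSet_ball]
        rfl
    _ = ∫⁻ x, ∫⁻ z, {p : E × E | p.2 ∈ ball p.1 r}.indicator (fun p => F p.2) (z, x) ∂μ ∂μ :=
        lintegral_lintegral_swap (hF.comp_snd.indicator hmeas)
    _ = ∫⁻ x, ∫⁻ z, (ball x r).indicator (fun _ => F x) z ∂μ ∂μ := by
        congr! 4 with x z
        classical exact if_congr mem_ball_comm rfl rfl
    _ = μ (ball 0 r) * ∫⁻ x, F x ∂μ := by
        simp only [lintegral_indicator_const measurableSet_ball, Measure.addHaar_ball_center]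
        rw [lintegral_mul_const'' _ hF, mul_comm]

lemma lintegral_le_of_forall_lintegral_ball_le {E : Type*} [NormedAddCommGroup E]
    [NormedSpace ℝ E] [FiniteDimensional ℝ E] [MeasurableSpace E] [BorelSpace E] (μ : Measure E)
    [μ.IsAddHaarMeasure] {F G : E → ℝ≥0∞} (hF : AEMeasurable F μ) (hG : AEMeasurable G μ)
    {r r' : ℝ} (hr : 0 < r) {c : ℝ≥0∞} (hc : c ≠ ⊤)
    (h : ∀ z, ∫⁻ x in ball z r, F x ∂μ ≤ c * ∫⁻ x in ball z r', G x ∂μ) :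
    ∫⁻ x, F x ∂μ ≤ c * ((μ (ball 0 r))⁻¹ * (μ (ball 0 r') * ∫⁻ x, G x ∂μ)) := by
  have hr0 : μ (ball 0 r) ≠ 0 := (measure_ball_pos μ _ hr).ne'
  calc ∫⁻ x, F x ∂μ = (μ (ball 0 r))⁻¹ * ∫⁻ z, ∫⁻ x in ball z r, F x ∂μ ∂μ := by
        rw [lintegral_lintegral_ball μ hF, ← mul_assoc,
          ENNReal.inv_mul_cancel hr0 measure_ball_lt_top.ne, one_mul]
    _ ≤ (μ (ball 0 r))⁻¹ * ∫⁻ z, c * ∫⁻ x in ball z r', G x ∂μ ∂μ :=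
        mul_le_mul' le_rfl (lintegral_mono h)
    _ = c * ((μ (ball 0 r))⁻¹ * (μ (ball 0 r') * ∫⁻ x, G x ∂μ)) := by
        rw [lintegral_const_mul' _ _ hc, lintegral_lintegral_ball μ hG]
        ring

lemma eLpNorm_norm_sq {α : Type*} [MeasurableSpace α] {μ : Measure α} (f : α → ℂ) :
    eLpNorm (fun x => ‖f x‖ ^ 2) 2 μ = eLpNorm f 4 μ ^ 2 := by
  have h := eLpNorm_norm_rpow (p := 2) (μ := μ) f (q := 2) two_pos
  rw [show (2 : ℝ≥0∞) * ENNReal.ofReal 2 = 4 by norm_num] at h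
  simpa only [Real.rpow_ofNat, ENNReal.rpow_ofNat] using h

lemma lintegral_mul_sq_le_eLpNorm_six {α : Type*} [MeasurableSpace α] {μ : Measure α}
    {W : α → ℝ} {f : α → ℂ} (hW : AEStronglyMeasurable W μ) (hf : AEStronglyMeasurable f μ) :
    ∫⁻ x, ‖W x‖ₑ * ‖f x‖ₑ ^ 2 ∂μ
      ≤ eLpNorm W 2 μ * (eLpNorm f 6 μ * μ Set.univ ^ (1 / 12 : ℝ)) ^ 2 := by
  have hfour : eLpNorm f 4 μ ≤ eLpNorm f 6 μ * μ Set.univ ^ (1 / 12 : ℝ) := by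
    convert eLpNorm_le_eLpNorm_mul_rpow_measure_univ (p := 4) (q := 6) (by norm_num) hf using 3
    norm_num
  have hprod : ∫⁻ x, ‖W x‖ₑ * ‖f x‖ₑ ^ 2 ∂μ = eLpNorm (W • fun x => ‖f x‖ ^ 2) 1 μ := by
    simp [eLpNorm_one_eq_lintegral_enorm]
  rw [hprod]
  refine (eLpNorm_smul_le_mul_eLpNorm (p := 2) (q := 2) (hf.norm.pow 2) hW).trans ?_
  rw [show eLpNorm ((fun x => ‖f x‖) ^ 2) 2 μ = _ from eLpNorm_norm_sq f]
  gcongr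

lemma exists_uniform_cutoff (E : Type*) [NormedAddCommGroup E] [InnerProductSpace ℝ E]
    [FiniteDimensional ℝ E] :
    ∃ C : ℝ≥0, ∀ z : E, ∃ χ : E → ℝ, ContDiff ℝ ∞ χ ∧ HasCompactSupport χ ∧
      tsupport χ ⊆ ball z 3 ∧ (∀ x ∈ ball z 1, χ x = 1) ∧
      (∀ x, |χ x| ≤ 1) ∧ ∀ x, ‖fderiv ℝ χ x‖ ≤ C := by
  let χ : ContDiffBump (0 : E) := ⟨1, 2, one_pos, one_lt_two⟩
  obtain ⟨C, hC⟩ := (BoundedSmooth.of_hasCompactSupport χ.contDiff χ.hasCompactSupport)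
    |>.exists_norm_fderiv_le
  refine ⟨C.toNNReal, fun z => ⟨fun x => χ (x - z),
    χ.contDiff.comp (contDiff_id.sub contDiff_const),
    χ.hasCompactSupport.comp_homeomorph (Homeomorph.subRight z),
    ?_, fun x hx => ?_, fun x => ?_, fun x => ?_⟩⟩
  · refine (closure_minimal (fun x hx => ?_) isClosed_closedBall).trans
      (closedBall_subset_ball (show (2 : ℝ) < 3 by norm_num))
    have : x - z ∈ Function.support χ := hx
    rw [χ.support_eq, mem_ball_zero_iff] at this
    exact mem_closedBall_iff_norm.2 this.le
  · exact χ.one_of_mem_closedBall (mem_closedBall_zero_iff.2 (mem_ball_iff_norm.1 hx).le)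
  · exact (abs_of_nonneg χ.nonneg).trans_le χ.le_one
  · rw [fderiv_comp_sub]
    exact (hC _).trans (Real.le_coe_toNNReal C)

variable {A : R3 → R3} {φ : R3 → ℂ}

lemma norm_mul_sub_mul_le {ι : Type*} [Fintype ι] {c d C : ℝ} (hc : |c| ≤ 1) (hd : |d| ≤ C) {z : ℂ}
    {w : ι → ℂ} (j : ι) :
    ‖c * w j - Complex.I * d * z‖ ≤ (1 + C) * √((∑ j, ‖w j‖ ^ 2) + ‖z‖ ^ 2) := by
  have hw : ‖w j‖ ≤ √((∑ j, ‖w j‖ ^ 2) + ‖z‖ ^ 2) := Real.le_sqrt_of_sq_le <|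
    (Finset.single_le_sum (f := fun j => ‖w j‖ ^ 2) (fun j _ => by positivity)
      (Finset.mem_univ j)).trans (le_add_of_nonneg_right (by positivity))
  have hz : ‖z‖ ≤ √((∑ j, ‖w j‖ ^ 2) + ‖z‖ ^ 2) := Real.le_sqrt_of_sq_le <|
    le_add_of_nonneg_left (Finset.sum_nonneg fun j _ => by positivity)
  have hC : 0 ≤ C := (abs_nonneg d).trans hd
  calc ‖c * w j - Complex.I * d * z‖ ≤ |c| * ‖w j‖ + |d| * ‖z‖ := by
        simpa using norm_sub_le (c * w j) (Complex.I * d * z)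
    _ ≤ 1 * √((∑ j, ‖w j‖ ^ 2) + ‖z‖ ^ 2) + C * √((∑ j, ‖w j‖ ^ 2) + ‖z‖ ^ 2) := by gcongr
    _ = _ := by ring

lemma exists_eLpNorm_six_ball_le (hA : ∀ j : Fin 3, L2Loc (fun x => A x j)) :
    ∃ K : ℝ≥0, ∀ (φ : R3 → ℂ) (g : Fin 3 → R3 → ℂ), MemLp φ 2 volume →
      (∀ j, HasMagneticDeriv (e j) (fun x => A x j) φ (g j)) → ∀ z,
        eLpNorm φ 6 (volume.restrict (ball z 1)) ≤ K *
          eLpNorm (fun x => √((∑ j, ‖g j x‖ ^ 2) + ‖φ x‖ ^ 2)) 2 (volume.restrict (ball z 3)) := by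
  obtain ⟨C, hC⟩ := exists_uniform_cutoff R3
  refine ⟨gnsConst * (3 * (1 + C)), fun φ g hφ hg z => ?_⟩
  obtain ⟨χ, hχ, hχs, hsupp, hone, hle_one, hderiv⟩ := hC z
  let N : R3 → ℝ := fun x => √((∑ j, ‖g j x‖ ^ 2) + ‖φ x‖ ^ 2)
  let g' : Fin 3 → R3 → ℂ := fun j x => χ x * g j x - Complex.I * (fderiv ℝ χ x (e j) : ℝ) * φ x
  have hbs : BoundedSmooth χ := .of_hasCompactSupport hχ hχs
  have hg' (j : Fin 3) := (hg j).mul_boundedSmooth (hA j) hφ hbs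
  have hzero (j : Fin 3) (x : R3) (hx : x ∉ tsupport χ) : g' j x = 0 := by
    have : fderiv ℝ χ x = 0 := image_eq_zero_of_notMem_tsupport
      fun h => hx (tsupport_fderiv_subset ℝ h)
    simp [g', image_eq_zero_of_notMem_tsupport hx, this]
  have hg'_le (j : Fin 3) :
      eLpNorm (g' j) 2 volume ≤ (1 + C) * eLpNorm N 2 (volume.restrict (ball z 3)) := by
    rw [← eLpNorm_restrict_eq_of_support_subset (s := ball z 3) fun x hx =>
      hsupp (by_contra fun h => hx (hzero j x h))]
    refine (eLpNorm_le_nnreal_smul_eLpNorm_of_ae_le_mul (g := N) (c := 1 + C)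
      (.of_forall fun x => ?_) 2).trans_eq (by simp [ENNReal.smul_def])
    have hd : |fderiv ℝ χ x (e j)| ≤ C := by
      simpa [e] using (fderiv ℝ χ x).le_of_opNorm_le (hderiv x) (e j)
    rw [← NNReal.coe_le_coe]
    simpa [N, g', abs_of_nonneg (Real.sqrt_nonneg _)] using
      norm_mul_sub_mul_le (z := φ x) (w := fun j => g j x) (hle_one x) hd j
  calc eLpNorm φ 6 (volume.restrict (ball z 1))
      = eLpNorm (fun x => χ x * φ x) 6 (volume.restrict (ball z 1)) := eLpNorm_congr_ae <|
        (ae_restrict_mem measurableSet_ball).mono fun x hx => by simp [hone x hx]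
    _ ≤ gnsConst * ∑ j, eLpNorm (g' j) 2 volume :=
        (eLpNorm_restrict_le _ _ _ _).trans <| eLpNorm_six_le_of_hasMagneticDeriv hA
          (hbs.memLp_mul hφ) (hχs.comp_left (g := Complex.ofReal) rfl).mul_right
          (fun j => .intro hχs.isCompact (hzero j)) hg'
    _ ≤ gnsConst * ∑ j : Fin 3, (1 + C) * eLpNorm N 2 (volume.restrict (ball z 3)) := by
        gcongr with j; exact hg'_le j
    _ = _ := by simp [N]; ring

lemma memLp_sqrt_sum_norm_sq_add {α ι : Type*} [MeasurableSpace α] {μ : Measure α} [Fintype ι]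
    {φ : α → ℂ} {g : ι → α → ℂ} (hφ : MemLp φ 2 μ) (hg : ∀ j, MemLp (g j) 2 μ) :
    MemLp (fun x => √((∑ j, ‖g j x‖ ^ 2) + ‖φ x‖ ^ 2)) 2 μ := by
  have hint : Integrable (fun x => (∑ j, ‖g j x‖ ^ 2) + ‖φ x‖ ^ 2) μ :=
    (integrable_finsetSum _ fun j _ => (hg j).integrable_norm_pow (by norm_num)).add
      (hφ.integrable_norm_pow (by norm_num))
  refine (memLp_two_iff_integrable_sq (Real.continuous_sqrt.comp_aestronglyMeasurable hint.1)).2 ?_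
  exact hint.congr (.of_forall fun x => (Real.sq_sqrt (by positivity)).symm)

lemma exists_lintegral_mul_sq_le (hA : ∀ j : Fin 3, L2Loc (fun x => A x j)) (hφ : φ ∈ H1 A) :
    ∃ B : ℝ≥0∞, B ≠ ⊤ ∧ ∀ (W : R3 → ℝ) (M : ℝ≥0), AEStronglyMeasurable W volume →
      (∀ z, eLpNorm W 2 (volume.restrict (ball z 1)) ≤ M) →
      ∫⁻ x, ‖W x‖ₑ * ‖φ x‖ₑ ^ 2 ≤ M * B := by
  obtain ⟨K, hK⟩ := exists_eLpNorm_six_ball_le hA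
  choose g hg using hφ.2
  let N : R3 → ℝ := fun x => √((∑ j, ‖g j x‖ ^ 2) + ‖φ x‖ ^ 2)
  have hN : MemLp N 2 volume := memLp_sqrt_sum_norm_sq_add hφ.1 fun j => (hg j).1
  have hN_sq (s : Set R3) :
      eLpNorm N 2 (volume.restrict s) ^ 2 = ∫⁻ x in s, ‖N x‖ₑ ^ 2 := by
    simpa using eLpNorm_nnreal_pow_eq_lintegral (f := N) (μ := volume.restrict s)
      (p := 2) two_ne_zero
  have hN_top : ∫⁻ x, ‖N x‖ₑ ^ 2 ≠ ⊤ := by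
    simpa using (hN_sq Set.univ).symm.trans_ne (ENNReal.pow_ne_top (hN.restrict _).2.ne)
  let v : ℝ → ℝ≥0∞ := fun r => volume (ball (0 : R3) r)
  have hv (r : ℝ) : v r ≠ ⊤ := measure_ball_lt_top.ne
  let κ : ℝ≥0∞ := (K * v 1 ^ (1 / 12 : ℝ)) ^ 2
  have hκ : κ ≠ ⊤ := ENNReal.pow_ne_top (ENNReal.mul_ne_top ENNReal.coe_ne_top
    (ENNReal.rpow_ne_top_of_nonneg (by norm_num) (hv 1)))
  refine ⟨κ * ((v 1)⁻¹ * (v 3 * ∫⁻ x, ‖N x‖ₑ ^ 2)), ?_, fun W M hW hM => ?_⟩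
  · exact ENNReal.mul_ne_top hκ (ENNReal.mul_ne_top
      (ENNReal.inv_ne_top.2 (measure_ball_pos _ _ one_pos).ne') (ENNReal.mul_ne_top (hv 3) hN_top))
  have hlocal (z : R3) : ∫⁻ x in ball z 1, ‖W x‖ₑ * ‖φ x‖ₑ ^ 2
      ≤ M * κ * ∫⁻ x in ball z 3, ‖N x‖ₑ ^ 2 := by
    refine (lintegral_mul_sq_le_eLpNorm_six hW.restrict hφ.1.1.restrict).trans ?_
    rw [← hN_sq, mul_assoc, ← mul_pow, Measure.restrict_apply_univ, Measure.addHaar_ball_center]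
    calc eLpNorm W 2 (volume.restrict (ball z 1)) *
          (eLpNorm φ 6 (volume.restrict (ball z 1)) * v 1 ^ (1 / 12 : ℝ)) ^ 2
        ≤ M * (K * eLpNorm N 2 (volume.restrict (ball z 3)) * v 1 ^ (1 / 12 : ℝ)) ^ 2 :=
          mul_le_mul' (hM z) (pow_le_pow_left' (mul_le_mul_left (hK φ g hφ.1 hg z) _) 2)
      _ = _ := by ring
  rw [← mul_assoc]
  exact lintegral_le_of_forall_lintegral_ball_le volume (hW.enorm.mul (hφ.1.1.enorm.pow_const 2))
    (hN.1.enorm.pow_const 2) one_pos (ENNReal.mul_ne_top ENNReal.coe_ne_top hκ) hlocal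

end FormBound

section Potentials

open Filter Topology Metric
open scoped ENNReal

lemma laplacian_comp_sub (f : R3 → ℂ) (z x : R3) :
    (Δ fun y => f (y - z)) x = (Δ f) (x - z) := by
  simp [InnerProductSpace.laplacian_eq_iteratedFDeriv_stdOrthonormalBasis, iteratedFDeriv_comp_sub]

lemma continuous_laplacian {f : R3 → ℂ} (hf : ContDiff ℝ ∞ f) : Continuous (Δ f) := by
  have hcont : Continuous (iteratedFDeriv ℝ 2 f) :=
    hf.continuous_iteratedFDeriv (m := 2) (WithTop.coe_le_coe.2 (le_top : (2 : ℕ∞) ≤ ⊤))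
  rw [InnerProductSpace.laplacian_eq_iteratedFDeriv_stdOrthonormalBasis]
  exact continuous_finsetSum _ fun i _ =>
    (ContinuousMultilinearMap.apply ℝ (fun _ : Fin 2 => R3) ℂ _).continuous.comp hcont

lemma hasCompactSupport_laplacian {f : R3 → ℂ} (hs : HasCompactSupport f) :
    HasCompactSupport (Δ f) := by
  refine (hs.iteratedFDeriv (𝕜 := ℝ) 2).mono fun x hx => ?_
  rw [Function.mem_support] at hx ⊢
  contrapose! hx
  simp [InnerProductSpace.laplacian_eq_iteratedFDeriv_stdOrthonormalBasis, hx]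

lemma eLpNorm_comp_sub_right {G F : Type*} [MeasurableSpace G] [AddGroup G] [MeasurableAdd₂ G]
    {μ : Measure G} [μ.IsAddRightInvariant] [NormedAddCommGroup F] {f : G → F}
    {p : ℝ≥0∞} (hf : AEStronglyMeasurable f μ) (z : G) :
    eLpNorm (fun x => f (x - z)) p μ = eLpNorm f p μ :=
  eLpNorm_comp_measurePreserving hf (measurePreserving_sub_right μ z)

lemma L2Loc.aestronglyMeasurable {V : R3 → ℝ} (hV : L2Loc V) : AEStronglyMeasurable V volume := by
  simpa only [iUnion_closedBall_nat, Measure.restrict_univ] using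
    aestronglyMeasurable_iUnion_iff.2 fun n : ℕ => (hV _ (isCompact_closedBall 0 (n : ℝ))).1

lemma InfinitesimallySmall.exists_eLpNorm_ball_le {V : R3 → ℝ} (hV : InfinitesimallySmall V) :
    ∃ M : ℝ≥0, ∀ z, eLpNorm V 2 (volume.restrict (ball z 1)) ≤ M := by
  obtain ⟨C, hC⟩ := hV 1 one_pos
  let χ : ContDiffBump (0 : R3) := ⟨1, 2, one_pos, one_lt_two⟩
  let η : R3 → ℂ := fun x => χ x
  have hη : ContDiff ℝ ∞ η := Complex.ofRealCLM.contDiff.comp χ.contDiff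
  have hs : HasCompactSupport η := χ.hasCompactSupport.comp_left (g := Complex.ofReal) rfl
  have hΔ : MemLp (Δ η) 2 volume :=
    (continuous_laplacian hη).memLp_of_hasCompactSupport (hasCompactSupport_laplacian hs)
  have hη_mem : MemLp η 2 volume := hη.continuous.memLp_of_hasCompactSupport hs
  have hfin : eLpNorm (Δ η) 2 volume + C * eLpNorm η 2 volume ≠ ⊤ :=
    ENNReal.add_ne_top.2 ⟨hΔ.2.ne, ENNReal.mul_ne_top ENNReal.coe_ne_top hη_mem.2.ne⟩
  refine ⟨_, fun z => le_of_le_of_eq ?_ (ENNReal.coe_toNNReal hfin).symm⟩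
  have hlap : eLpNorm (Δ fun x => η (x - z)) 2 volume = eLpNorm (Δ η) 2 volume := by
    rw [funext (laplacian_comp_sub η z), eLpNorm_comp_sub_right hΔ.1]
  have hone (x : R3) (hx : x ∈ ball z 1) : χ (x - z) = 1 :=
    χ.one_of_mem_closedBall (mem_closedBall_zero_iff.2 (mem_ball_iff_norm.1 hx).le)
  calc eLpNorm V 2 (volume.restrict (ball z 1))
      ≤ eLpNorm (fun x => (V x : ℂ) * η (x - z)) 2 (volume.restrict (ball z 1)) :=
        eLpNorm_mono_ae <| (ae_restrict_mem measurableSet_ball).mono fun x hx => by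
          simp [η, hone x hx]
    _ ≤ eLpNorm (fun x => (V x : ℂ) * η (x - z)) 2 volume := eLpNorm_restrict_le _ _ _ _
    _ ≤ eLpNorm (Δ η) 2 volume + C * eLpNorm η 2 volume := by
        simpa only [hlap, eLpNorm_comp_sub_right hη_mem.1, ENNReal.coe_one, one_mul] using
           hC (fun x => η (x - z)) (hη.comp (contDiff_id.sub contDiff_const))
            (hs.comp_homeomorph (Homeomorph.subRight z))

lemma memLp_two_indicator_ball_inv_norm :
    MemLp ((ball (0 : R3) 1).indicator fun x => 1 / ‖x‖) 2 volume := by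
  rw [memLp_indicator_iff_restrict measurableSet_ball, memLp_two_iff_integrable_sq
    (measurable_norm.const_div 1).aestronglyMeasurable]
  refine (integrableOn_fun_norm_addHaar volume (f := fun r : ℝ => (1 / r) ^ 2) (r := 1)).2 ?_
  refine (integrableOn_const (C := (1 : ℝ)) (by simp)).congr_fun (fun r hr => ?_) measurableSet_Ioo
  have : r ≠ 0 := hr.1.ne'
  simp [this]

lemma exists_eLpNorm_inv_norm_sub_ball_le :
    ∃ M : ℝ≥0, ∀ y z : R3,
      eLpNorm (fun x => 1 / ‖x - y‖) 2 (volume.restrict (ball z 1)) ≤ M := by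
  let k : R3 → ℝ := (ball (0 : R3) 1).indicator fun x => 1 / ‖x‖
  have hk : MemLp k 2 volume := memLp_two_indicator_ball_inv_norm
  let v := volume (ball (0 : R3) 1)
  have hfin : eLpNorm k 2 volume + v ^ (1 / 2 : ℝ) ≠ ⊤ := ENNReal.add_ne_top.2
    ⟨hk.2.ne, ENNReal.rpow_ne_top_of_nonneg (by norm_num) measure_ball_lt_top.ne⟩
  refine ⟨_, fun y z => le_of_le_of_eq ?_ (ENNReal.coe_toNNReal hfin).symm⟩
  have hpres := measurePreserving_sub_right (volume : Measure R3) y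
  have hle (x : R3) : ‖1 / ‖x - y‖‖ ≤ k (x - y) + 1 := by
    rw [Real.norm_of_nonneg (by positivity)]
    by_cases hx : x - y ∈ ball (0 : R3) 1
    · simp [k, Set.indicator_of_mem hx]
    · have : 1 ≤ ‖x - y‖ := by simpa using hx
      simpa [k, Set.indicator_of_notMem hx] using inv_le_one_of_one_le₀ this
  have hkle : eLpNorm (fun x => k (x - y)) 2 (volume.restrict (ball z 1)) ≤ eLpNorm k 2 volume :=
    (eLpNorm_restrict_le _ _ _ _).trans_eq (eLpNorm_comp_sub_right hk.1 y)
  have hone : eLpNorm (fun _ : R3 => (1 : ℝ)) 2 (volume.restrict (ball z 1)) = v ^ (1 / 2 : ℝ) := by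
    rw [eLpNorm_const' _ two_ne_zero ENNReal.ofNat_ne_top]
    simp [v, Measure.addHaar_ball_center]
  calc eLpNorm (fun x => 1 / ‖x - y‖) 2 (volume.restrict (ball z 1))
      ≤ eLpNorm (fun x => k (x - y) + 1) 2 (volume.restrict (ball z 1)) := eLpNorm_mono_real hle
    _ ≤ eLpNorm (fun x => k (x - y)) 2 (volume.restrict (ball z 1))
          + eLpNorm (fun _ : R3 => (1 : ℝ)) 2 (volume.restrict (ball z 1)) :=
        eLpNorm_add_le (hk.comp_measurePreserving hpres).1.restrict aestronglyMeasurable_const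
          one_le_two
    _ ≤ eLpNorm k 2 volume + v ^ (1 / 2 : ℝ) := add_le_add hkle hone.le

variable {A : R3 → R3} {V : R3 → ℝ} {φ : R3 → ℂ}

lemma enorm_mul_norm_sq (r : ℝ) (z : ℂ) : ‖r * ‖z‖ ^ 2‖ₑ = ‖r‖ₑ * ‖z‖ₑ ^ 2 := by
  rw [enorm_mul, enorm_pow, enorm_norm]

lemma integrable_potential_mul_norm_sq (hA : ∀ j : Fin 3, L2Loc (fun x => A x j)) (hV : L2Loc V)
    (hVs : InfinitesimallySmall V) (hφ : φ ∈ H1 A) :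
    Integrable (fun x => V x * ‖φ x‖ ^ 2) volume := by
  obtain ⟨B, hB, h⟩ := exists_lintegral_mul_sq_le hA hφ
  obtain ⟨M, hM⟩ := hVs.exists_eLpNorm_ball_le
  refine ⟨hV.aestronglyMeasurable.mul (hφ.1.1.norm.pow 2), ?_⟩
  rw [hasFiniteIntegral_iff_enorm]
  simp only [enorm_mul_norm_sq]
  exact (h V M hV.aestronglyMeasurable hM).trans_lt
    (ENNReal.mul_lt_top ENNReal.coe_lt_top hB.lt_top)

lemma exists_integral_coulomb_le (hA : ∀ j : Fin 3, L2Loc (fun x => A x j)) (hφ : φ ∈ H1 A) :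
    ∃ C : ℝ, ∀ y, Integrable (fun x => 1 / ‖x - y‖ * ‖φ x‖ ^ 2) volume ∧
      ∫ x, 1 / ‖x - y‖ * ‖φ x‖ ^ 2 ≤ C := by
  obtain ⟨B, hB, h⟩ := exists_lintegral_mul_sq_le hA hφ
  obtain ⟨M, hM⟩ := exists_eLpNorm_inv_norm_sub_ball_le
  have hMB : M * B ≠ ⊤ := ENNReal.mul_ne_top ENNReal.coe_ne_top hB
  refine ⟨(M * B).toReal, fun y => ?_⟩
  have hmeas : AEStronglyMeasurable (fun x : R3 => 1 / ‖x - y‖) volume :=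
    ((measurable_id.sub measurable_const).norm.const_div 1).aestronglyMeasurable
  have hprod : AEStronglyMeasurable (fun x => 1 / ‖x - y‖ * ‖φ x‖ ^ 2) volume :=
    hmeas.mul (hφ.1.1.norm.pow 2)
  have hle : ∫⁻ x, ‖1 / ‖x - y‖ * ‖φ x‖ ^ 2‖ₑ ≤ M * B := by
    simpa only [enorm_mul_norm_sq] using h _ M hmeas (hM y)
  refine ⟨⟨hprod, hle.trans_lt hMB.lt_top⟩, ?_⟩
  rw [integral_eq_lintegral_of_nonneg_ae (.of_forall fun x => by positivity) hprod]
  refine ENNReal.toReal_mono hMB ((lintegral_mono fun x => ?_).trans hle)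
  exact Real.ofReal_le_enorm _

/-- The Coulomb energy density `|φ(x)|² |φ(y)|² / |x - y|` of the pair `(x, y)`. -/
noncomputable def coulombDensity (φ : R3 → ℂ) (p : R3 × R3) : ℝ :=
  ‖φ p.1‖ ^ 2 * ‖φ p.2‖ ^ 2 / ‖p.1 - p.2‖

lemma integrable_coulombDensity (hA : ∀ j : Fin 3, L2Loc (fun x => A x j)) (hφ : φ ∈ H1 A) :
    Integrable (coulombDensity φ) volume := by
  obtain ⟨C, hC⟩ := exists_integral_coulomb_le hA hφ
  have hn : Integrable (fun x => ‖φ x‖ ^ 2) volume := hφ.1.integrable_norm_pow two_ne_zero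
  have hmeas : AEStronglyMeasurable (coulombDensity φ) (volume.prod volume) :=
    (hn.1.comp_fst.mul hn.1.comp_snd).div₀
      (measurable_fst.sub measurable_snd).norm.aestronglyMeasurable
  have hslice (x y : R3) :
      coulombDensity φ (x, y) = ‖φ y‖ ^ 2 * (1 / ‖x - y‖ * ‖φ x‖ ^ 2) := by
    rw [coulombDensity]; ring
  refine (integrable_prod_iff' hmeas).2 ⟨.of_forall fun y => ?_, ?_⟩
  · simpa only [hslice] using (hC y).1.const_mul _
  · refine (hn.const_mul C).mono' hmeas.norm.prod_swap.integral_prod_right' (.of_forall fun y => ?_)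
    have hnorm (x : R3) : ‖coulombDensity φ (x, y)‖ = ‖φ y‖ ^ 2 * (1 / ‖x - y‖ * ‖φ x‖ ^ 2) := by
      rw [hslice, Real.norm_of_nonneg (by positivity)]
    simp only [hnorm, integral_const_mul]
    rw [norm_mul, norm_pow, norm_norm, Real.norm_of_nonneg (integral_nonneg fun x => by positivity),
      mul_comm]
    exact mul_le_mul_of_nonneg_right (hC y).2 (by positivity)

end Potentials

/-! ### Modulation of the density -/

namespace BoundedSmooth

variable {E F : Type*} [NormedAddCommGroup E] [NormedSpace ℝ E] [NormedAddCommGroup F]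
  [NormedSpace ℝ F] {f : E → ℝ}

lemma comp_continuousLinearMap (hf : BoundedSmooth f) (L : F →L[ℝ] E) :
    BoundedSmooth fun x => f (L x) := by
  obtain ⟨C, hC⟩ := hf.exists_abs_le
  obtain ⟨C', hC'⟩ := hf.exists_norm_fderiv_le
  refine ⟨hf.contDiff.comp L.contDiff, ⟨C, fun x => hC (L x)⟩, C' * ‖L‖, fun x => ?_⟩
  have : HasFDerivAt (fun x => f (L x)) ((fderiv ℝ f (L x)).comp L) x :=
    (hf.contDiff.differentiable (by simp) (L x)).hasFDerivAt.comp x L.hasFDerivAt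
  rw [this.fderiv]
  exact (ContinuousLinearMap.opNorm_comp_le _ _).trans
    (mul_le_mul_of_nonneg_right (hC' (L x)) (norm_nonneg L))

lemma sub_const (hf : BoundedSmooth f) (c : ℝ) : BoundedSmooth fun x => f x - c := by
  obtain ⟨C, hC⟩ := hf.exists_abs_le
  refine ⟨hf.contDiff.sub contDiff_const, ⟨C + |c|, fun x => ?_⟩, ?_⟩
  · exact (abs_sub _ _).trans (add_le_add_left (hC x) _)
  · simpa only [fderiv_sub_const] using hf.exists_norm_fderiv_le

lemma eventually_half_le (hf : BoundedSmooth f) :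
    ∀ᶠ s in nhds (0 : ℝ), ∀ x, 1 / 2 ≤ 1 + s * f x := by
  obtain ⟨C, hC⟩ := hf.exists_abs_le
  have hlim : Filter.Tendsto (fun s : ℝ => |s| * C) (nhds 0) (nhds 0) :=
    Continuous.tendsto' (by fun_prop) 0 0 (by simp)
  filter_upwards [hlim.eventually_le_const (half_pos one_pos)] with s hs x
  have : |s * f x| ≤ 1 / 2 := by
    rw [abs_mul]; exact (mul_le_mul_of_nonneg_left (hC x) (abs_nonneg s)).trans hs
  linarith [neg_le_of_abs_le this]

lemma hasFDerivAt_sqrt_one_add_mul (hf : BoundedSmooth f) {s : ℝ} {x : E}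
    (hs : 1 / 2 ≤ 1 + s * f x) : HasFDerivAt (fun x => √(1 + s * f x))
      ((s / (2 * √(1 + s * f x))) • fderiv ℝ f x) x := by
  have := (((hf.contDiff.differentiable (by simp) x).hasFDerivAt.const_mul s).const_add 1).sqrt
    (by linarith : 1 + s * f x ≠ 0)
  simpa only [smul_smul, div_eq_inv_mul, mul_one, one_mul] using this

lemma sqrt_one_add_mul (hf : BoundedSmooth f) {s : ℝ} (hs : ∀ x, 1 / 2 ≤ 1 + s * f x) :
    BoundedSmooth fun x => √(1 + s * f x) := by
  obtain ⟨C, hC⟩ := hf.exists_abs_le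
  obtain ⟨C', hC'⟩ := hf.exists_norm_fderiv_le
  refine ⟨(contDiff_const.add (contDiff_const.mul hf.contDiff)).sqrt fun x => by linarith [hs x],
    ⟨√(1 + |s| * C), fun x => ?_⟩, |s| * C', fun x => ?_⟩
  · rw [abs_of_nonneg (Real.sqrt_nonneg _)]
    refine Real.sqrt_le_sqrt (add_le_add_right ((le_abs_self _).trans ?_) _)
    rw [abs_mul]
    exact mul_le_mul_of_nonneg_left (hC x) (abs_nonneg s)
  · have hsqrt : 1 ≤ 2 * √(1 + s * f x) := by
      linarith [Real.le_sqrt_of_sq_le (by linarith [hs x] : (1 / 2 : ℝ) ^ 2 ≤ 1 + s * f x)]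
    rw [(hf.hasFDerivAt_sqrt_one_add_mul (hs x)).fderiv, norm_smul, Real.norm_eq_abs, abs_div,
      abs_of_pos (by linarith : 0 < 2 * √(1 + s * f x))]
    exact mul_le_mul (div_le_self (abs_nonneg s) hsqrt) (hC' x) (norm_nonneg _) (abs_nonneg s)

lemma integrable_mul [MeasurableSpace E] [OpensMeasurableSpace E] {μ : Measure E} {h : E → ℝ}
    (hf : BoundedSmooth f) (hh : Integrable h μ) : Integrable (fun x => f x * h x) μ := by
  obtain ⟨C, hC⟩ := hf.exists_abs_le
  exact hh.bdd_mul hf.contDiff.continuous.aestronglyMeasurable (.of_forall hC)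

lemma integrable_fderiv_mul [MeasurableSpace E] [OpensMeasurableSpace E] {μ : Measure E}
    {h : E → ℝ} (hf : BoundedSmooth f) (v : E) (hh : Integrable h μ) :
    Integrable (fun x => fderiv ℝ f x v * h x) μ := by
  obtain ⟨C, hC⟩ := hf.exists_abs_fderiv_apply_le v
  exact hh.bdd_mul (continuous_fderiv_apply hf.contDiff v).aestronglyMeasurable (.of_forall hC)

end BoundedSmooth

section Modulation

open ComplexConjugate

variable {α ι : Type*} [Fintype ι]

/-- The state with the phase of `ψ` and the density `(1 + s f) |ψ|²`. -/
noncomputable def modulate (s : ℝ) (f : α → ℝ) (ψ : α → ℂ) (x : α) : ℂ :=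
  (√(1 + s * f x) : ℝ) * ψ x

/-- The energy density `∑ⱼ |gⱼ|² + W |ψ|²` of a state `ψ` with derivatives `gⱼ` in the external
potential `W`. -/
noncomputable def energyDensity (W : α → ℝ) (ψ : α → ℂ) (g : ι → α → ℂ) (x : α) : ℝ :=
  (∑ j, ‖g j x‖ ^ 2) + W x * ‖ψ x‖ ^ 2

lemma norm_sq_modulate {s : ℝ} {f : α → ℝ} {x : α} (hs : 0 ≤ 1 + s * f x) (ψ : α → ℂ) :
    ‖modulate s f ψ x‖ ^ 2 = (1 + s * f x) * ‖ψ x‖ ^ 2 := by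
  rw [modulate, norm_mul, mul_pow, Complex.norm_real, Real.norm_eq_abs, sq_abs, Real.sq_sqrt hs]

lemma integrable_energyDensity [MeasurableSpace α] {μ : Measure α} {W : α → ℝ} {ψ : α → ℂ}
    {g : ι → α → ℂ} (hg : ∀ j, MemLp (g j) 2 μ) (hW : Integrable (fun x => W x * ‖ψ x‖ ^ 2) μ) :
    Integrable (energyDensity W ψ g) μ :=
  (integrable_finsetSum _ fun j _ => (hg j).integrable_norm_pow two_ne_zero).add hW

variable {E : Type*} [NormedAddCommGroup E] [NormedSpace ℝ E] {v : ι → E} {a : ι → E → ℝ}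
  {W f : E → ℝ} {ψ : E → ℂ} {g : ι → E → ℂ} {s : ℝ}

/-- The derivative at `s = 0` of the energy density of `modulate s f ψ`, where `g j` is the
magnetic derivative of `ψ` in the direction `v j`. The last factor is half the derivative of
`|ψ|²` in this direction. -/
noncomputable def energyVariation (v : ι → E) (f W : E → ℝ) (ψ : E → ℂ) (g : ι → E → ℂ)
    (x : E) : ℝ :=
  f x * energyDensity W ψ g x + ∑ j, fderiv ℝ f x (v j) * (conj (g j x) * ψ x).im

/-- The magnetic derivative of `modulate s f ψ` in the direction `w`, where `h` is that of `ψ`. -/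
noncomputable def modulateDeriv (s : ℝ) (f : E → ℝ) (w : E) (ψ h : E → ℂ) (x : E) : ℂ :=
  (√(1 + s * f x) : ℝ) * h x - Complex.I * (fderiv ℝ (fun x => √(1 + s * f x)) x w : ℝ) * ψ x

lemma norm_sq_ofReal_mul_sub_I_mul (r t : ℝ) (z w : ℂ) :
    ‖(r : ℂ) * z - Complex.I * t * w‖ ^ 2
      = r ^ 2 * ‖z‖ ^ 2 + 2 * r * t * (conj z * w).im + t ^ 2 * ‖w‖ ^ 2 := by
  simp only [Complex.sq_norm, Complex.normSq_apply, Complex.sub_re, Complex.sub_im, Complex.mul_re,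
    Complex.mul_im, Complex.conj_re, Complex.conj_im, Complex.ofReal_re, Complex.ofReal_im,
    Complex.I_re, Complex.I_im]
  ring

lemma norm_sq_modulateDeriv_le (hf : BoundedSmooth f) {x : E} (hs : 1 / 2 ≤ 1 + s * f x) (w : E)
    (ψ h : E → ℂ) :
    ‖modulateDeriv s f w ψ h x‖ ^ 2 ≤ ‖h x‖ ^ 2
      + s * (f x * ‖h x‖ ^ 2 + fderiv ℝ f x w * (conj (h x) * ψ x).im)
      + s ^ 2 * (fderiv ℝ f x w * (fderiv ℝ f x w * ‖ψ x‖ ^ 2)) := by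
  have hpos : 0 < 1 + s * f x := by linarith
  have hsqrt : √(1 + s * f x) ≠ 0 := (Real.sqrt_pos.2 hpos).ne'
  have hsq : √(1 + s * f x) ^ 2 = 1 + s * f x := Real.sq_sqrt hpos.le
  rw [modulateDeriv, norm_sq_ofReal_mul_sub_I_mul,
    (hf.hasFDerivAt_sqrt_one_add_mul hs).fderiv, smul_apply, smul_eq_mul]
  set d := fderiv ℝ f x w
  have hcross : 2 * √(1 + s * f x) * (s / (2 * √(1 + s * f x)) * d) = s * d := by field_simp
  have hquad : (s / (2 * √(1 + s * f x)) * d) ^ 2 ≤ s ^ 2 * d ^ 2 := by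
    rw [mul_pow, div_pow, mul_pow, hsq]
    exact mul_le_mul_of_nonneg_right (div_le_self (sq_nonneg s) (by linarith)) (sq_nonneg d)
  rw [hcross, hsq]
  linarith [mul_le_mul_of_nonneg_right hquad (sq_nonneg ‖ψ x‖)]

lemma energyDensity_modulate_le (hf : BoundedSmooth f) {x : E} (hs : 1 / 2 ≤ 1 + s * f x) :
    energyDensity W (modulate s f ψ) (fun j => modulateDeriv s f (v j) ψ (g j)) x
      ≤ energyDensity W ψ g x + s * energyVariation v f W ψ g x
        + s ^ 2 * ∑ j, fderiv ℝ f x (v j) * (fderiv ℝ f x (v j) * ‖ψ x‖ ^ 2) := by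
  have hsum := Finset.sum_le_sum fun j (_ : j ∈ Finset.univ) =>
    norm_sq_modulateDeriv_le hf hs (v j) ψ (g j)
  simp only [Finset.sum_add_distrib, ← Finset.mul_sum] at hsum
  rw [energyDensity, norm_sq_modulate (by linarith)]
  simp only [energyVariation, energyDensity]
  linarith

variable [MeasureSpace E] [BorelSpace E]

lemma integrable_energyVariation (hψ : MemLp ψ 2 volume) (hg : ∀ j, MemLp (g j) 2 volume)
    (hW : Integrable (fun x => W x * ‖ψ x‖ ^ 2) volume) (hf : BoundedSmooth f) (v : ι → E) :
    Integrable (energyVariation v f W ψ g) volume :=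
  (hf.integrable_mul (integrable_energyDensity hg hW)).add <|
    integrable_finsetSum _ fun j _ =>
      hf.integrable_fderiv_mul (v j) ((hg j).star.integrable_mul hψ).im

lemma memLp_modulate (hψ : MemLp ψ 2 volume) (hf : BoundedSmooth f)
    (hs : ∀ x, 1 / 2 ≤ 1 + s * f x) : MemLp (modulate s f ψ) 2 volume :=
  (hf.sqrt_one_add_mul hs).memLp_mul hψ

lemma integral_norm_sq_modulate (hψ : MemLp ψ 2 volume) (hf : BoundedSmooth f)
    (hs : ∀ x, 1 / 2 ≤ 1 + s * f x) (hmean : ∫ x, f x * ‖ψ x‖ ^ 2 = 0) :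
    ∫ x, ‖modulate s f ψ x‖ ^ 2 = ∫ x, ‖ψ x‖ ^ 2 := by
  have hn : Integrable (fun x => ‖ψ x‖ ^ 2) volume := hψ.integrable_norm_pow two_ne_zero
  have hexpand (x : E) : ‖modulate s f ψ x‖ ^ 2 = ‖ψ x‖ ^ 2 + s * (f x * ‖ψ x‖ ^ 2) := by
    rw [norm_sq_modulate (by linarith [hs x])]; ring
  simp only [hexpand]
  rw [integral_add hn ((hf.integrable_mul hn).const_mul s), integral_const_mul, hmean, mul_zero,
    add_zero]

variable [IsFiniteMeasureOnCompacts (volume : Measure E)]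

lemma HasMagneticDeriv.modulate {w : E} {b : E → ℝ} {h : E → ℂ}
    (hb : ∀ K : Set E, IsCompact K → MemLp b 2 (volume.restrict K)) (hψ : MemLp ψ 2 volume)
    (hd : HasMagneticDeriv w b ψ h) (hf : BoundedSmooth f) (hs : ∀ x, 1 / 2 ≤ 1 + s * f x) :
    HasMagneticDeriv w b (modulate s f ψ) (modulateDeriv s f w ψ h) :=
  hd.mul_boundedSmooth hb hψ (hf.sqrt_one_add_mul hs)

lemma exists_integral_energyDensity_modulate_le
    (ha : ∀ j, ∀ K : Set E, IsCompact K → MemLp (a j) 2 (volume.restrict K))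
    (hψ : MemLp ψ 2 volume) (hg : ∀ j, HasMagneticDeriv (v j) (a j) ψ (g j))
    (hW : Integrable (fun x => W x * ‖ψ x‖ ^ 2) volume) (hf : BoundedSmooth f) :
    ∃ C, ∀ s, (∀ x, 1 / 2 ≤ 1 + s * f x) →
      ∫ x, energyDensity W (modulate s f ψ) (fun j => modulateDeriv s f (v j) ψ (g j)) x
        ≤ (∫ x, energyDensity W ψ g x) + s * (∫ x, energyVariation v f W ψ g x) + s ^ 2 * C := by
  refine ⟨∫ x, ∑ j, fderiv ℝ f x (v j) * (fderiv ℝ f x (v j) * ‖ψ x‖ ^ 2), fun s hs => ?_⟩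
  have hg₂ (j : ι) : MemLp (g j) 2 volume := (hg j).1
  have hd := integrable_energyDensity hg₂ hW
  have hlin : Integrable (fun x => energyDensity W ψ g x + s * energyVariation v f W ψ g x)
      volume := hd.add ((integrable_energyVariation hψ hg₂ hW hf v).const_mul s)
  have hquad : Integrable (fun x =>
      s ^ 2 * ∑ j, fderiv ℝ f x (v j) * (fderiv ℝ f x (v j) * ‖ψ x‖ ^ 2)) volume :=
    (integrable_finsetSum _ fun j _ => hf.integrable_fderiv_mul (v j)
      (hf.integrable_fderiv_mul (v j) (hψ.integrable_norm_pow two_ne_zero))).const_mul _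
  have hWmod : Integrable (fun x => W x * ‖modulate s f ψ x‖ ^ 2) volume := by
    refine (hW.add ((hf.integrable_mul hW).const_mul s)).congr (.of_forall fun x => ?_)
    simp only [Pi.add_apply, norm_sq_modulate (by linarith [hs x] : 0 ≤ 1 + s * f x)]
    ring
  rw [← integral_const_mul, ← integral_const_mul,
    ← integral_add hd ((integrable_energyVariation hψ hg₂ hW hf v).const_mul s),
    ← integral_add hlin hquad]
  exact integral_mono
    (integrable_energyDensity (fun j => ((hg j).modulate (ha j) hψ hf hs).1) hWmod)
    (hlin.add hquad) fun x => energyDensity_modulate_le hf (hs x)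

end Modulation

lemma frequently_mul_add_sq_mul_neg {c : ℝ} (hc : c ≠ 0) (C : ℝ) :
    ∃ᶠ s in nhds (0 : ℝ), s * c + s ^ 2 * C < 0 := by
  refine fun hev => hc ?_
  have hmin : IsLocalMin (fun s : ℝ => s * c + s ^ 2 * C) 0 := by
    filter_upwards [hev] with s hs using by simpa using hs
  have hderiv : HasDerivAt (fun s : ℝ => s * c + s ^ 2 * C) c 0 := by
    simpa using ((hasDerivAt_id (0 : ℝ)).mul_const c).fun_add
      (((hasDerivAt_id (0 : ℝ)).pow 2).mul_const C)
  exact hmin.hasDerivAt_eq_zero hderiv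

lemma integral_one_add_mul_one_add_mul {E : Type*} [NormedAddCommGroup E] [NormedSpace ℝ E]
    [MeasureSpace E] [BorelSpace E] [SecondCountableTopology E] [SFinite (volume : Measure E)]
    {k : E × E → ℝ} {f : E → ℝ} (hk : Integrable k volume) (hsymm : ∀ p, k p.swap = k p)
    (hf : BoundedSmooth f) (s : ℝ) :
    ∫ p : E × E, (1 + s * f p.1) * (1 + s * f p.2) * k p
      = (∫ p, k p) + s * (2 * ∫ p : E × E, f p.1 * k p)
        + s ^ 2 * ∫ p : E × E, f p.1 * (f p.2 * k p) := by
  have hswap : ∫ p : E × E, f p.2 * k p = ∫ p : E × E, f p.1 * k p := by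
    rw [Measure.volume_eq_prod, ← integral_prod_swap]
    simp only [hsymm, Prod.snd_swap]
  have hf₁ := hf.comp_continuousLinearMap (.fst ℝ E E)
  have hf₂ := hf.comp_continuousLinearMap (.snd ℝ E E)
  have hk₁ : Integrable (fun p : E × E => s * (f p.1 * k p)) volume :=
    (hf₁.integrable_mul hk).const_mul s
  have hk₂ : Integrable (fun p : E × E => s * (f p.2 * k p)) volume :=
    (hf₂.integrable_mul hk).const_mul s
  have hk₁₂ : Integrable (fun p : E × E => s ^ 2 * (f p.1 * (f p.2 * k p))) volume :=
    (hf₁.integrable_mul (hf₂.integrable_mul hk)).const_mul (s ^ 2)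
  have hlin : Integrable (fun p : E × E => k p + s * (f p.1 * k p)) volume := hk.add hk₁
  have hlin' : Integrable (fun p : E × E => k p + s * (f p.1 * k p) + s * (f p.2 * k p))
      volume := hlin.add hk₂
  have hexpand (p : E × E) : (1 + s * f p.1) * (1 + s * f p.2) * k p
      = k p + s * (f p.1 * k p) + s * (f p.2 * k p) + s ^ 2 * (f p.1 * (f p.2 * k p)) := by ring
  simp only [hexpand]
  rw [integral_add hlin' hk₁₂, integral_add hlin hk₂, integral_add hk hk₁]
  simp only [integral_const_mul, hswap]
  ring

section EulerLagrange

variable {A : R3 → R3} {V : R3 → ℝ} {φ : R3 → ℂ} {g : Fin 3 → R3 → ℂ}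

lemma coulombDensity_swap (φ : R3 → ℂ) (p : R3 × R3) :
    coulombDensity φ p.swap = coulombDensity φ p := by
  simp only [coulombDensity, Prod.fst_swap, Prod.snd_swap, norm_sub_rev p.2 p.1]
  ring

lemma pekar_eq (hg : ∀ j, HasMagneticDeriv (e j) (fun x => A x j) φ (g j)) :
    pekar A V φ = (∫ x, energyDensity V φ g x) - ∫ p, coulombDensity φ p := by
  rw [pekar, coulomb]
  congr 1
  refine integral_congr_ae ?_
  filter_upwards [ae_all_iff.2 fun j => (hg j).magneticDeriv_ae_eq] with x hx
  simp only [D, hx, energyDensity]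

lemma coulombDensity_modulate {s : ℝ} {f : R3 → ℝ} (hs : ∀ x, 0 ≤ 1 + s * f x) (φ : R3 → ℂ)
    (p : R3 × R3) :
    coulombDensity (modulate s f φ) p
      = (1 + s * f p.1) * (1 + s * f p.2) * coulombDensity φ p := by
  rw [coulombDensity, coulombDensity, norm_sq_modulate (hs _), norm_sq_modulate (hs _)]
  ring

lemma exists_pekar_modulate_le (hA : ∀ j : Fin 3, L2Loc (fun x => A x j)) (hφ : φ ∈ H1 A)
    (hVφ : Integrable (fun x => V x * ‖φ x‖ ^ 2) volume)
    (hg : ∀ j, HasMagneticDeriv (e j) (fun x => A x j) φ (g j)) {f : R3 → ℝ}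
    (hf : BoundedSmooth f) :
    ∃ C, ∀ s, (∀ x, 1 / 2 ≤ 1 + s * f x) → pekar A V (modulate s f φ) ≤ pekar A V φ
      + s * ((∫ x, energyVariation e f V φ g x) - 2 * ∫ p : R3 × R3, f p.1 * coulombDensity φ p)
      + s ^ 2 * C := by
  obtain ⟨C, hC⟩ := exists_integral_energyDensity_modulate_le hA hφ.1 hg hVφ hf
  refine ⟨C - ∫ p : R3 × R3, f p.1 * (f p.2 * coulombDensity φ p), fun s hs => ?_⟩
  have hs₀ (x : R3) : 0 ≤ 1 + s * f x := by linarith [hs x]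
  rw [pekar_eq hg, pekar_eq fun j => (hg j).modulate (hA j) hφ.1 hf hs]
  simp only [coulombDensity_modulate hs₀]
  rw [integral_one_add_mul_one_add_mul (integrable_coulombDensity hA hφ) (coulombDensity_swap φ)
    hf s]
  linarith [hC s hs]

lemma IsPekarMinimizer.integral_energyVariation_eq (hA : ∀ j : Fin 3, L2Loc (fun x => A x j))
    (hφ : IsPekarMinimizer A V φ) (hVφ : Integrable (fun x => V x * ‖φ x‖ ^ 2) volume)
    (hg : ∀ j, HasMagneticDeriv (e j) (fun x => A x j) φ (g j)) {f : R3 → ℝ}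
    (hf : BoundedSmooth f) (hmean : ∫ x, f x * ‖φ x‖ ^ 2 = 0) :
    ∫ x, energyVariation e f V φ g x = 2 * ∫ p : R3 × R3, f p.1 * coulombDensity φ p := by
  obtain ⟨⟨hH, hnorm⟩, hmin⟩ := hφ
  obtain ⟨C, hC⟩ := exists_pekar_modulate_le hA hH hVφ hg hf
  by_contra hne
  obtain ⟨s, hneg, hs⟩ :=
    ((frequently_mul_add_sq_mul_neg (sub_ne_zero.2 hne) C).and_eventually
      hf.eventually_half_le).exists
  have hmem : modulate s f φ ∈ pekarDomain A 1 :=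
    ⟨⟨memLp_modulate hH.1 hf hs, fun j => ⟨_, (hg j).modulate (hA j) hH.1 hf hs⟩⟩,
      (integral_norm_sq_modulate hH.1 hf hs hmean).trans hnorm⟩
  linarith [isMinOn_iff.1 hmin _ hmem, hC s hs]

end EulerLagrange

/-! ### Correlated product states -/

section PartialMean

lemma integrable_slice_mul {α β : Type*} [TopologicalSpace α] [TopologicalSpace β]
    [MeasureSpace β] [OpensMeasurableSpace β] {ρ : β → ℝ} (hρ : Integrable ρ volume)
    {b : α × β → ℝ} (hb : Continuous b) {C : ℝ} (hC : ∀ p, |b p| ≤ C) (x : α) :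
    Integrable (fun y => b (x, y) * ρ y) volume :=
  hρ.bdd_mul (hb.comp (.prodMk_right x)).aestronglyMeasurable (.of_forall fun y => hC (x, y))

variable {E F : Type*} [NormedAddCommGroup E] [NormedSpace ℝ E] [NormedAddCommGroup F]
  [NormedSpace ℝ F] {w : E × F → ℝ}

/-- The mean `∫ w(x, y) ρ(y) dy` of `w(x, ·)` with respect to the density `ρ`. -/
noncomputable def partialMean {α β : Type*} [MeasureSpace β] (ρ : β → ℝ)
    (w : α × β → ℝ) (x : α) : ℝ :=
  ∫ y, w (x, y) * ρ y

lemma norm_smul_comp_inl_le {L : E × F →L[ℝ] ℝ} {C : ℝ} (hL : ‖L‖ ≤ C) (r : ℝ) :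
    ‖r • L.comp (.inl ℝ E F)‖ ≤ C * |r| := by
  rw [norm_smul, Real.norm_eq_abs, mul_comm]
  refine mul_le_mul_of_nonneg_right ?_ (abs_nonneg r)
  calc ‖L.comp (.inl ℝ E F)‖
      ≤ ‖L‖ * ‖ContinuousLinearMap.inl ℝ E F‖ := ContinuousLinearMap.opNorm_comp_le _ _
    _ ≤ ‖L‖ := mul_le_of_le_one_right (norm_nonneg L) (ContinuousLinearMap.norm_inl_le_one ℝ E F)
    _ ≤ C := hL

variable [MeasureSpace F] [BorelSpace F] [SecondCountableTopology F] {ρ : F → ℝ}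

lemma hasFDerivAt_partialMean (hw : BoundedSmooth w) (hρ : Integrable ρ volume) (x : E) :
    Integrable (fun y => ρ y • (fderiv ℝ w (x, y)).comp (.inl ℝ E F)) volume ∧
      HasFDerivAt (partialMean ρ w) (∫ y, ρ y • (fderiv ℝ w (x, y)).comp (.inl ℝ E F)) x := by
  obtain ⟨C, hC⟩ := hw.exists_abs_le
  obtain ⟨C', hC'⟩ := hw.exists_norm_fderiv_le
  have hcont : Continuous fun y => (fderiv ℝ w (x, y)).comp (ContinuousLinearMap.inl ℝ E F) :=
    ((hw.contDiff.continuous_fderiv (by simp)).comp (.prodMk_right x)).clm_comp continuous_const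
  have hmeas : AEStronglyMeasurable (fun y => ρ y • (fderiv ℝ w (x, y)).comp (.inl ℝ E F)) volume :=
    hρ.1.smul hcont.aestronglyMeasurable
  have hle (z : E) (y : F) : ‖ρ y • (fderiv ℝ w (z, y)).comp (.inl ℝ E F)‖ ≤ C' * |ρ y| :=
    norm_smul_comp_inl_le (hC' (z, y)) (ρ y)
  have hbound : Integrable (fun y => C' * |ρ y|) volume := hρ.abs.const_mul C'
  have hint (z : E) := integrable_slice_mul hρ hw.contDiff.continuous hC z
  refine ⟨hbound.mono' hmeas (.of_forall (hle x)), ?_⟩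
  refine hasFDerivAt_integral_of_dominated_of_fderiv_le Filter.univ_mem
    (.of_forall fun z => (hint z).1) (hint x) hmeas (.of_forall fun y z _ => hle z y)
    hbound (.of_forall fun y z _ => ?_)
  exact ((hw.contDiff.differentiable (by simp) (z, y)).hasFDerivAt.comp z
    (hasFDerivAt_prodMk_left z y)).mul_const (ρ y)

lemma fderiv_partialMean (hw : BoundedSmooth w) (hρ : Integrable ρ volume) (x v : E) :
    fderiv ℝ (partialMean ρ w) x v = ∫ y, fderiv ℝ w (x, y) (v, 0) * ρ y := by
  obtain ⟨hint, hderiv⟩ := hasFDerivAt_partialMean hw hρ x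
  rw [hderiv.fderiv, ContinuousLinearMap.integral_apply hint]
  simp [mul_comm]

lemma boundedSmooth_partialMean (hw : BoundedSmooth w) (hρ : Integrable ρ volume)
    (hsmooth : ContDiff ℝ ∞ (partialMean ρ w)) : BoundedSmooth (partialMean ρ w) := by
  obtain ⟨C, hC⟩ := hw.exists_abs_le
  obtain ⟨C', hC'⟩ := hw.exists_norm_fderiv_le
  refine ⟨hsmooth, ⟨∫ y, C * |ρ y|, fun x => ?_⟩, ∫ y, C' * |ρ y|, fun x => ?_⟩
  · rw [partialMean, ← Real.norm_eq_abs]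
    refine norm_integral_le_of_norm_le (hρ.abs.const_mul C) (.of_forall fun y => ?_)
    rw [Real.norm_eq_abs, abs_mul]
    exact mul_le_mul_of_nonneg_right (hC (x, y)) (abs_nonneg (ρ y))
  · rw [(hasFDerivAt_partialMean hw hρ x).2.fderiv]
    refine norm_integral_le_of_norm_le (hρ.abs.const_mul C') (.of_forall fun y => ?_)
    exact norm_smul_comp_inl_le (hC' (x, y)) (ρ y)

end PartialMean

section ProductState

open ComplexConjugate

variable {α ι : Type*}

/-- The product state `φ ⊗ φ`. -/
def productState (φ : α → ℂ) (p : α × α) : ℂ := φ p.1 * φ p.2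

lemma norm_sq_productState (φ : α → ℂ) (p : α × α) :
    ‖productState φ p‖ ^ 2 = ‖φ p.1‖ ^ 2 * ‖φ p.2‖ ^ 2 := by
  rw [productState, norm_mul, mul_pow]

variable [Fintype ι]

lemma energyDensity_productState (W : α → ℝ) (φ : α → ℂ) (g : ι → α → ℂ) (p : α × α) :
    energyDensity (fun p => W p.1) (productState φ) (fun j p => g j p.1 * φ p.2) p
      = energyDensity W φ g p.1 * ‖φ p.2‖ ^ 2 := by
  simp only [energyDensity, norm_sq_productState, norm_mul, mul_pow, ← Finset.sum_mul]
  ring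

variable [MeasureSpace α] {W : α → ℝ} {φ : α → ℂ} {g : ι → α → ℂ}

lemma integrable_mul_norm_sq_productState (hφ : MemLp φ 2 volume)
    (hW : Integrable (fun x => W x * ‖φ x‖ ^ 2) volume) :
    Integrable (fun p : α × α => W p.1 * ‖productState φ p‖ ^ 2) volume := by
  simp only [norm_sq_productState, ← mul_assoc]
  exact hW.mul_prod (hφ.integrable_norm_pow two_ne_zero)

lemma memLp_productState (hφ : MemLp φ 2 volume) : MemLp (productState φ) 2 volume :=
  memLp_two_tensor hφ hφ

variable [SFinite (volume : Measure α)]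

lemma integral_norm_sq_productState (hφ : ∫ x, ‖φ x‖ ^ 2 = 1) :
    ∫ p, ‖productState φ p‖ ^ 2 = 1 := by
  simp only [norm_sq_productState]
  rw [Measure.volume_eq_prod, integral_prod_mul (‖φ ·‖ ^ 2) (‖φ ·‖ ^ 2), hφ, one_mul]

lemma integral_energyDensity_productState (hφ : ∫ x, ‖φ x‖ ^ 2 = 1) :
    ∫ p, energyDensity (fun p => W p.1) (productState φ) (fun j p => g j p.1 * φ p.2) p
      = ∫ x, energyDensity W φ g x := by
  simp only [energyDensity_productState]
  rw [Measure.volume_eq_prod, integral_prod_mul (energyDensity W φ g) (‖φ ·‖ ^ 2), hφ, mul_one]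

lemma conj_mul_mul_mul (a b c : ℂ) : conj (a * c) * (b * c) = (‖c‖ ^ 2 : ℝ) * (conj a * b) := by
  rw [map_mul, ← Complex.normSq_eq_norm_sq, Complex.normSq_eq_conj_mul_self]
  ring

variable {E : Type*} [NormedAddCommGroup E] [NormedSpace ℝ E] [MeasureSpace E]
  [BorelSpace E] [SecondCountableTopology E] {v : ι → E} {W : E → ℝ} {φ : E → ℂ} {g : ι → E → ℂ}
  {w : E × E → ℝ}

lemma integral_energyVariation_productState_slice (hφ : MemLp φ 2 volume) (hw : BoundedSmooth w)
    (x : E) :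
    ∫ y, energyVariation (fun j => (v j, (0 : E))) w (fun p => W p.1) (productState φ)
        (fun j p => g j p.1 * φ p.2) (x, y)
      = energyVariation v (partialMean (‖φ ·‖ ^ 2) w) W φ g x := by
  have hn : Integrable (‖φ ·‖ ^ 2) volume := hφ.integrable_norm_pow two_ne_zero
  obtain ⟨C, hC⟩ := hw.exists_abs_le
  choose C' hC' using fun j => hw.exists_abs_fderiv_apply_le (v j, (0 : E))
  have hdens : Integrable (fun y => w (x, y) * ‖φ y‖ ^ 2 * energyDensity W φ g x) volume :=
    (integrable_slice_mul hn hw.contDiff.continuous hC x).mul_const _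
  have hcross (j : ι) : Integrable (fun y => fderiv ℝ w (x, y) (v j, 0) * ‖φ y‖ ^ 2
      * (conj (g j x) * φ x).im) volume :=
    (integrable_slice_mul hn (continuous_fderiv_apply hw.contDiff _) (hC' j) x).mul_const _
  have hslice (y : E) : energyVariation (fun j => (v j, (0 : E))) w (fun p => W p.1)
      (productState φ) (fun j p => g j p.1 * φ p.2) (x, y)
      = w (x, y) * ‖φ y‖ ^ 2 * energyDensity W φ g x
        + ∑ j, fderiv ℝ w (x, y) (v j, 0) * ‖φ y‖ ^ 2 * (conj (g j x) * φ x).im := by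
    simp only [energyVariation, energyDensity_productState, productState, conj_mul_mul_mul,
      Complex.im_ofReal_mul, mul_assoc]
    ring
  simp only [hslice]
  rw [integral_add hdens (integrable_finsetSum _ fun j _ => hcross j),
    integral_finsetSum _ fun j _ => hcross j]
  simp only [integral_mul_const, energyVariation, fderiv_partialMean hw hn, partialMean]

variable [SFinite (volume : Measure E)]

lemma integral_energyVariation_productState (hφ : MemLp φ 2 volume)
    (hg : ∀ j, MemLp (g j) 2 volume) (hW : Integrable (fun x => W x * ‖φ x‖ ^ 2) volume)
    (hw : BoundedSmooth w) :
    ∫ p, energyVariation (fun j => (v j, (0 : E))) w (fun p => W p.1) (productState φ)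
        (fun j p => g j p.1 * φ p.2) p
      = ∫ x, energyVariation v (partialMean (‖φ ·‖ ^ 2) w) W φ g x := by
  rw [Measure.volume_eq_prod, integral_prod _ (integrable_energyVariation (memLp_productState hφ)
    (fun j => memLp_two_tensor (hg j) hφ) (integrable_mul_norm_sq_productState hφ hW) hw _)]
  simp only [integral_energyVariation_productState_slice hφ hw]

lemma integral_partialMean_mul (hφ : MemLp φ 2 volume) (hw : BoundedSmooth w) :
    ∫ x, partialMean (‖φ ·‖ ^ 2) w x * ‖φ x‖ ^ 2 = ∫ p, w p * ‖productState φ p‖ ^ 2 := by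
  rw [Measure.volume_eq_prod, integral_prod _
    (hw.integrable_mul ((memLp_productState hφ).integrable_norm_pow two_ne_zero))]
  simp only [norm_sq_productState, partialMean, ← integral_mul_const]
  congr 1 with x
  congr 1 with y
  ring

end ProductState

section PairEnergy

variable {A : R3 → R3} {V : R3 → ℝ} {φ : R3 → ℂ} {w : R3 × R3 → ℝ} {s : ℝ}

lemma pekarTomasevich_eq_of_symm {ψ : R3 × R3 → ℂ} (hsymm : ∀ p, ψ p.swap = ψ p)
    {g : Fin 3 → R3 × R3 → ℂ}
    (hg : ∀ j, HasMagneticDeriv (e j, (0 : R3)) (fun p : R3 × R3 => A p.1 j) ψ (g j)) (U : ℝ) :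
    pekarTomasevich A V U ψ = 2 * (∫ p, energyDensity (fun p : R3 × R3 => V p.1) ψ g p)
      + U * (∫ p : R3 × R3, ‖ψ p‖ ^ 2 / ‖p.1 - p.2‖) - coulomb (pairDensity ψ) := by
  have hg' (j : Fin 3) : HasMagneticDeriv ((0 : R3), e j) (fun p : R3 × R3 => A p.2 j) ψ
      (fun p => g j p.swap) := by
    simpa only [hsymm] using HasMagneticDeriv.swap (a := fun x => A x j) (hg j)
  have hfst : ∫ p : R3 × R3, ((∑ j, ‖D₁ A j ψ p‖ ^ 2) + V p.1 * ‖ψ p‖ ^ 2)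
      = ∫ p, energyDensity (fun p : R3 × R3 => V p.1) ψ g p := by
    refine integral_congr_ae ?_
    filter_upwards [ae_all_iff.2 fun j => (hg j).magneticDeriv_ae_eq] with p hp
    simp only [D₁, hp, energyDensity]
  have hsnd : ∫ p : R3 × R3, ((∑ j, ‖D₂ A j ψ p‖ ^ 2) + V p.2 * ‖ψ p‖ ^ 2)
      = ∫ p, energyDensity (fun p : R3 × R3 => V p.1) ψ g p := by
    rw [Measure.volume_eq_prod,
      ← integral_prod_swap (energyDensity (fun p : R3 × R3 => V p.1) ψ g)]
    refine integral_congr_ae ?_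
    filter_upwards [ae_all_iff.2 fun j => (hg' j).magneticDeriv_ae_eq] with p hp
    simp only [D₂, hp, energyDensity, Prod.fst_swap, hsymm]
  rw [pekarTomasevich, hfst, hsnd]
  ring

lemma modulate_productState_swap (hsymm : ∀ p, w p.swap = w p) (p : R3 × R3) :
    modulate s w (productState φ) p.swap = modulate s w (productState φ) p := by
  simp only [modulate, hsymm, productState, Prod.fst_swap, Prod.snd_swap, mul_comm (φ p.2)]

lemma pairDensity_modulate_productState (hφ : MemLp φ 2 volume) (hφ₁ : ∫ x, ‖φ x‖ ^ 2 = 1)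
    (hw : BoundedSmooth w) (hsymm : ∀ p, w p.swap = w p) (hs : ∀ p, 0 ≤ 1 + s * w p) (x : R3) :
    pairDensity (modulate s w (productState φ)) x
      = 2 * (1 + s * partialMean (‖φ ·‖ ^ 2) w x) * ‖φ x‖ ^ 2 := by
  have hn : Integrable (fun y => ‖φ y‖ ^ 2) volume := hφ.integrable_norm_pow two_ne_zero
  obtain ⟨C, hC⟩ := hw.exists_abs_le
  have hslice (y : R3) : ‖modulate s w (productState φ) (x, y)‖ ^ 2
      + ‖modulate s w (productState φ) (y, x)‖ ^ 2
      = 2 * ‖φ x‖ ^ 2 * (‖φ y‖ ^ 2 + s * (w (x, y) * ‖φ y‖ ^ 2)) := by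
    rw [← modulate_productState_swap hsymm (y, x), Prod.swap_prod_mk, norm_sq_modulate (hs _),
      norm_sq_productState]
    ring
  simp only [pairDensity, hslice]
  rw [integral_const_mul, integral_add hn
    ((integrable_slice_mul hn hw.contDiff.continuous hC x).const_mul s), integral_const_mul, hφ₁,
    partialMean]
  ring

lemma coulomb_pairDensity_modulate (hφ : MemLp φ 2 volume) (hφ₁ : ∫ x, ‖φ x‖ ^ 2 = 1)
    (hw : BoundedSmooth w) (hsymm : ∀ p, w p.swap = w p) (hs : ∀ p, 0 ≤ 1 + s * w p) :
    coulomb (pairDensity (modulate s w (productState φ)))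
      = 4 * ∫ p : R3 × R3, (1 + s * partialMean (‖φ ·‖ ^ 2) w p.1)
          * (1 + s * partialMean (‖φ ·‖ ^ 2) w p.2) * coulombDensity φ p := by
  simp only [coulomb, pairDensity_modulate_productState hφ hφ₁ hw hsymm hs, coulombDensity]
  rw [← integral_const_mul]
  congr 1 with p
  ring

lemma integral_norm_sq_modulate_productState_div
    (hk : Integrable (coulombDensity φ) volume) (hw : BoundedSmooth w)
    (hs : ∀ p, 0 ≤ 1 + s * w p) :
    ∫ p : R3 × R3, ‖modulate s w (productState φ) p‖ ^ 2 / ‖p.1 - p.2‖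
      = (∫ p, coulombDensity φ p) + s * ∫ p, w p * coulombDensity φ p := by
  have hexpand (p : R3 × R3) : ‖modulate s w (productState φ) p‖ ^ 2 / ‖p.1 - p.2‖
      = coulombDensity φ p + s * (w p * coulombDensity φ p) := by
    rw [norm_sq_modulate (hs p), norm_sq_productState, coulombDensity]
    ring
  simp only [hexpand]
  rw [integral_add hk ((hw.integrable_mul hk).const_mul s), integral_const_mul]

lemma exists_pekarTomasevich_two_modulate_le (hA : ∀ j : Fin 3, L2Loc (fun x => A x j))
    (hφ : φ ∈ pekarDomain A 1) (hVφ : Integrable (fun x => V x * ‖φ x‖ ^ 2) volume)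
    {g : Fin 3 → R3 → ℂ} (hg : ∀ j, HasMagneticDeriv (e j) (fun x => A x j) φ (g j))
    (hw : BoundedSmooth w) (hsymm : ∀ p, w p.swap = w p)
    (hm : BoundedSmooth (partialMean (‖φ ·‖ ^ 2) w)) :
    ∃ C, ∀ s, (∀ p, 1 / 2 ≤ 1 + s * w p) →
      pekarTomasevich A V 2 (modulate s w (productState φ)) ≤ 2 * pekar A V φ
        + s * (2 * (∫ x, energyVariation e (partialMean (‖φ ·‖ ^ 2) w) V φ g x)
          + 2 * (∫ p, w p * coulombDensity φ p)
          - 8 * ∫ p : R3 × R3, partialMean (‖φ ·‖ ^ 2) w p.1 * coulombDensity φ p)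
        + s ^ 2 * C := by
  obtain ⟨hH, hφ₁⟩ := hφ
  have hk := integrable_coulombDensity hA hH
  have hgφ (j : Fin 3) : HasMagneticDeriv (e j, (0 : R3)) (fun p : R3 × R3 => A p.1 j)
      (productState φ) (fun p => g j p.1 * φ p.2) := (hg j).tensor (hA j) hH.1 hH.1
  have hA₁ (j : Fin 3) := memLp_restrict_comp_fst (hA j)
  obtain ⟨C, hC⟩ := exists_integral_energyDensity_modulate_le hA₁ (memLp_productState hH.1) hgφ
    (integrable_mul_norm_sq_productState hH.1 hVφ) hw
  rw [integral_energyDensity_productState hφ₁,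
    integral_energyVariation_productState hH.1 (fun j => (hg j).1) hVφ hw] at hC
  refine ⟨2 * C - 4 * ∫ p : R3 × R3, partialMean (‖φ ·‖ ^ 2) w p.1
    * (partialMean (‖φ ·‖ ^ 2) w p.2 * coulombDensity φ p), fun s hs => ?_⟩
  have hs₀ (p : R3 × R3) : 0 ≤ 1 + s * w p := by linarith [hs p]
  rw [pekarTomasevich_eq_of_symm (modulate_productState_swap hsymm)
      (fun j => (hgφ j).modulate (hA₁ j) (memLp_productState hH.1) hw hs),
    coulomb_pairDensity_modulate hH.1 hφ₁ hw hsymm hs₀,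
    integral_norm_sq_modulate_productState_div hk hw hs₀,
    integral_one_add_mul_one_add_mul hk (coulombDensity_swap φ) hm s, pekar_eq hg]
  linarith [hC s hs]

lemma modulate_productState_mem_H1Pair (hA : ∀ j : Fin 3, L2Loc (fun x => A x j)) (hφ : φ ∈ H1 A)
    (hw : BoundedSmooth w) (hsymm : ∀ p, w p.swap = w p) (hs : ∀ p, 1 / 2 ≤ 1 + s * w p) :
    modulate s w (productState φ) ∈ H1Pair A := by
  have hderiv (j : Fin 3) : ∃ g, HasMagneticDeriv (e j, (0 : R3)) (fun p : R3 × R3 => A p.1 j)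
      (modulate s w (productState φ)) g := by
    obtain ⟨g, hg⟩ := hφ.2 j
    exact ⟨_, (hg.tensor (hA j) hφ.1 hφ.1).modulate (memLp_restrict_comp_fst (hA j))
      (memLp_productState hφ.1) hw hs⟩
  refine ⟨memLp_modulate (memLp_productState hφ.1) hw hs, hderiv, fun j => ?_⟩
  obtain ⟨g, hg⟩ := hderiv j
  refine ⟨fun p => g p.swap, ?_⟩
  simpa only [modulate_productState_swap hsymm] using
    HasMagneticDeriv.swap (a := fun x => A x j) hg

lemma IsPekarMinimizer.exists_pekarTomasevich_two_lt (hA : ∀ j : Fin 3, L2Loc (fun x => A x j))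
    (hφ : IsPekarMinimizer A V φ) (hVφ : Integrable (fun x => V x * ‖φ x‖ ^ 2) volume)
    (hw : BoundedSmooth w) (hsymm : ∀ p, w p.swap = w p)
    (hm : BoundedSmooth (partialMean (‖φ ·‖ ^ 2) w))
    (hmean : ∫ p, w p * ‖productState φ p‖ ^ 2 = 0)
    (hne : ∫ p, w p * coulombDensity φ p
      ≠ 2 * ∫ p : R3 × R3, partialMean (‖φ ·‖ ^ 2) w p.1 * coulombDensity φ p) :
    ∃ ψ ∈ H1Pair A, ∫ p, ‖ψ p‖ ^ 2 = 1 ∧ pekarTomasevich A V 2 ψ < 2 * pekar A V φ := by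
  have hH := hφ.1.1
  choose g hg using hH.2
  obtain ⟨C, hC⟩ := exists_pekarTomasevich_two_modulate_le hA hφ.1 hVφ hg hw hsymm hm
  rw [hφ.integral_energyVariation_eq hA hVφ hg hm
    ((integral_partialMean_mul hH.1 hw).trans hmean)] at hC
  obtain ⟨s, hneg, hs⟩ :=
    ((frequently_mul_add_sq_mul_neg (mul_ne_zero two_ne_zero (sub_ne_zero.2 hne)) C).and_eventually
      hw.eventually_half_le).exists
  refine ⟨modulate s w (productState φ), modulate_productState_mem_H1Pair hA hH hw hsymm hs,
    ?_, ?_⟩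
  · rw [integral_norm_sq_modulate (memLp_productState hH.1) hw hs hmean,
      integral_norm_sq_productState hφ.1.2]
  · linarith [hC s hs]

end PairEnergy

/-! ### Correlations concentrated at the diagonal -/

section DiagonalBump

lemma exists_pos_integral_ball {X : Type*} [PseudoMetricSpace X] [SecondCountableTopology X]
    [MeasureSpace X] {f : X → ℝ} (hf : Integrable f volume) (hf₀ : ∀ x, 0 ≤ f x)
    (hpos : 0 < ∫ x, f x) {r : ℝ} (hr : 0 < r) : ∃ z, 0 < ∫ x in Metric.ball z r, f x := by
  have hsupp : 0 < volume (Function.support f) :=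
    (integral_pos_iff_support_of_nonneg hf₀ hf).1 hpos
  obtain ⟨z, -, hz⟩ := exists_mem_forall_mem_nhdsWithin_pos_measure hsupp.ne'
  refine ⟨z, (setIntegral_pos_iff_support_of_nonneg_ae (.of_forall hf₀) hf.integrableOn).2 ?_⟩
  exact hz _ (inter_mem_nhdsWithin _ (Metric.ball_mem_nhds z hr))

lemma ae_fst_ne_snd {X : Type*} [TopologicalSpace X] [T2Space X] [SecondCountableTopology X]
    [MeasureSpace X] [OpensMeasurableSpace X] [SFinite (volume : Measure X)]
    [NullSingletonClass (volume : Measure X)] : ∀ᵐ p : X × X, p.1 ≠ p.2 := by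
  have hdiag : MeasurableSet {p : X × X | p.1 ≠ p.2} := isClosed_diagonal.measurableSet.compl
  rw [Measure.volume_eq_prod]
  exact (Measure.ae_prod_iff_ae_ae hdiag).2
    (.of_forall fun x => (Measure.ae_ne volume x).mono fun y => Ne.symm)

lemma exists_diagonal_bump {E : Type*} [NormedAddCommGroup E] [NormedSpace ℝ E]
    [HasContDiffBump E] [FiniteDimensional ℝ E] [MeasureSpace E] [BorelSpace E] {ρ : E → ℝ}
    (hρ : Integrable ρ volume) {ε : ℝ} (hε : 0 < ε) :
    ∃ w : E × E → ℝ, BoundedSmooth w ∧ BoundedSmooth (partialMean ρ w) ∧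
      (∀ p, w p.swap = w p) ∧ (∀ p, 0 ≤ w p) ∧ (∀ p, ‖p.1 - p.2‖ ≤ ε / 2 → w p = 1) ∧
      ∀ p, ε ≤ ‖p.1 - p.2‖ → w p = 0 := by
  let b : ContDiffBump (0 : E) := ⟨ε / 2, ε, half_pos hε, half_lt_self hε⟩
  have hw : BoundedSmooth fun p : E × E => b (p.1 - p.2) :=
    (BoundedSmooth.of_hasCompactSupport b.contDiff b.hasCompactSupport).comp_continuousLinearMap
      (.fst ℝ E E - .snd ℝ E E)
  have hconv : partialMean ρ (fun p : E × E => b (p.1 - p.2))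
      = convolution ρ b (.lsmul ℝ ℝ) volume := by
    ext x
    simp [partialMean, convolution, mul_comm]
  refine ⟨_, hw, boundedSmooth_partialMean hw hρ ?_, fun p => ?_, fun p => b.nonneg,
    fun p hp => b.one_of_mem_closedBall (mem_closedBall_zero_iff.2 hp),
    fun p hp => b.zero_of_le_dist (hp.trans_eq (dist_zero_right _).symm)⟩
  · rw [hconv]
    exact b.hasCompactSupport.contDiff_convolution_right _ hρ.locallyIntegrable b.contDiff
  · rw [Prod.fst_swap, Prod.snd_swap, ← b.neg, neg_sub]

variable {A : R3 → R3} {φ : R3 → ℂ} {w : R3 × R3 → ℝ} {ε C : ℝ}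

lemma integral_mul_norm_sq_productState_pos {E : Type*} [NormedAddCommGroup E]
    [NormedSpace ℝ E] [MeasureSpace E] [BorelSpace E] [SecondCountableTopology E]
    [SFinite (volume : Measure E)] {φ : E → ℂ} {w : E × E → ℝ} (hφ : MemLp φ 2 volume)
    (hφ₀ : 0 < ∫ x, ‖φ x‖ ^ 2) (hw : BoundedSmooth w) (hw₀ : ∀ p, 0 ≤ w p) {δ : ℝ} (hδ : 0 < δ)
    (hw₁ : ∀ p, ‖p.1 - p.2‖ ≤ δ → w p = 1) :
    0 < ∫ p, w p * ‖productState φ p‖ ^ 2 := by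
  obtain ⟨z, hz⟩ := exists_pos_integral_ball (hφ.integrable_norm_pow two_ne_zero)
    (fun x => by positivity) hφ₀ (half_pos hδ)
  set B := Metric.ball z (δ / 2)
  have hB : MeasurableSet (B ×ˢ B) := measurableSet_ball.prod measurableSet_ball
  calc 0 < (∫ x in B, ‖φ x‖ ^ 2) * ∫ x in B, ‖φ x‖ ^ 2 := mul_pos hz hz
    _ = ∫ p in B ×ˢ B, ‖φ p.1‖ ^ 2 * ‖φ p.2‖ ^ 2 := by
      rw [Measure.volume_eq_prod, setIntegral_prod_mul (‖φ ·‖ ^ 2) (‖φ ·‖ ^ 2)]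
    _ = ∫ p in B ×ˢ B, w p * ‖productState φ p‖ ^ 2 := by
      refine setIntegral_congr_fun hB fun p hp => ?_
      have hdist : ‖p.1 - p.2‖ ≤ δ := by
        rw [← dist_eq_norm]
        linarith [dist_triangle_right p.1 p.2 z, Metric.mem_ball.1 hp.1, Metric.mem_ball.1 hp.2]
      simp only [hw₁ p hdist, one_mul, norm_sq_productState]
    _ ≤ ∫ p, w p * ‖productState φ p‖ ^ 2 :=
      setIntegral_le_integral
        (hw.integrable_mul ((memLp_productState hφ).integrable_norm_pow two_ne_zero))
        (.of_forall fun p => mul_nonneg (hw₀ p) (by positivity))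

lemma le_integral_mul_coulombDensity (hφ : MemLp φ 2 volume)
    (hk : Integrable (coulombDensity φ) volume) (hw : BoundedSmooth w) (hw₀ : ∀ p, 0 ≤ w p)
    (hsupp : ∀ p, ε ≤ ‖p.1 - p.2‖ → w p = 0) :
    ε⁻¹ * ∫ p, w p * ‖productState φ p‖ ^ 2 ≤ ∫ p, w p * coulombDensity φ p := by
  rw [← integral_const_mul]
  refine integral_mono_ae
    ((hw.integrable_mul ((memLp_productState hφ).integrable_norm_pow two_ne_zero)).const_mul _)
    (hw.integrable_mul hk) ?_
  filter_upwards [ae_fst_ne_snd] with p hp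
  obtain hfar | hnear := le_or_gt ε ‖p.1 - p.2‖
  · simp only [hsupp p hfar, zero_mul, mul_zero, le_refl]
  · have hd : 0 < ‖p.1 - p.2‖ := norm_pos_iff.2 (sub_ne_zero.2 hp)
    calc ε⁻¹ * (w p * ‖productState φ p‖ ^ 2)
        ≤ ‖p.1 - p.2‖⁻¹ * (w p * ‖productState φ p‖ ^ 2) := by
          gcongr
          exact mul_nonneg (hw₀ p) (by positivity)
      _ = w p * coulombDensity φ p := by
        rw [norm_sq_productState, coulombDensity]
        ring

lemma integral_comp_fst_mul_coulombDensity_le (hφ : MemLp φ 2 volume)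
    (hk : Integrable (coulombDensity φ) volume)
    (hC : ∀ y, ∫ x, 1 / ‖x - y‖ * ‖φ x‖ ^ 2 ≤ C) {f : R3 → ℝ} (hf : BoundedSmooth f)
    (hf₀ : ∀ x, 0 ≤ f x) :
    ∫ p : R3 × R3, f p.1 * coulombDensity φ p ≤ C * ∫ x, f x * ‖φ x‖ ^ 2 := by
  have hint : Integrable (fun p : R3 × R3 => f p.1 * coulombDensity φ p)
      (volume.prod volume) :=
    (hf.comp_continuousLinearMap (.fst ℝ R3 R3)).integrable_mul hk
  have hslice (x y : R3) : f x * coulombDensity φ (x, y)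
      = f x * ‖φ x‖ ^ 2 * (1 / ‖y - x‖ * ‖φ y‖ ^ 2) := by
    rw [coulombDensity, norm_sub_rev]
    ring
  rw [Measure.volume_eq_prod, integral_prod _ hint, ← integral_const_mul]
  refine integral_mono hint.integral_prod_left
    ((hf.integrable_mul (hφ.integrable_norm_pow two_ne_zero)).const_mul C) fun x => ?_
  simp only [hslice, integral_const_mul]
  rw [mul_comm C]
  exact mul_le_mul_of_nonneg_left (hC x) (mul_nonneg (hf₀ x) (by positivity))

lemma exists_diagonal_bump_coulomb_lt (hA : ∀ j : Fin 3, L2Loc (fun x => A x j)) (hφ : φ ∈ H1 A)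
    (hφ₁ : ∫ x, ‖φ x‖ ^ 2 = 1) :
    ∃ w, BoundedSmooth w ∧ BoundedSmooth (partialMean (‖φ ·‖ ^ 2) w) ∧ (∀ p, w p.swap = w p) ∧
      0 < ∫ p, w p * ‖productState φ p‖ ^ 2 ∧
      2 * ∫ p : R3 × R3, partialMean (‖φ ·‖ ^ 2) w p.1 * coulombDensity φ p
        < ∫ p, w p * coulombDensity φ p := by
  have hk := integrable_coulombDensity hA hφ
  obtain ⟨C, hC⟩ := exists_integral_coulomb_le hA hφ
  have hC₀ : 0 ≤ C := (integral_nonneg fun x => by positivity).trans (hC 0).2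
  obtain ⟨w, hw, hmw, hsymm, hw₀, hw₁, hsupp⟩ := exists_diagonal_bump
    (hφ.1.integrable_norm_pow two_ne_zero) (ε := (2 * C + 1)⁻¹) (by positivity)
  have hpos : 0 < ∫ p, w p * ‖productState φ p‖ ^ 2 :=
    integral_mul_norm_sq_productState_pos hφ.1 (hφ₁ ▸ one_pos) hw hw₀ (by positivity) hw₁
  refine ⟨w, hw, hmw, hsymm, hpos, ?_⟩
  have hmw₀ (x : R3) : 0 ≤ partialMean (‖φ ·‖ ^ 2) w x :=
    integral_nonneg fun y => mul_nonneg (hw₀ (x, y)) (by positivity)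
  have hle := integral_comp_fst_mul_coulombDensity_le hφ.1 hk (fun y => (hC y).2) hmw hmw₀
  rw [integral_partialMean_mul hφ.1 hw] at hle
  have hge := le_integral_mul_coulombDensity hφ.1 hk hw hw₀ hsupp
  rw [inv_inv] at hge
  linarith

lemma partialMean_sub_const (hφ : MemLp φ 2 volume) (hφ₁ : ∫ x, ‖φ x‖ ^ 2 = 1)
    (hw : BoundedSmooth w) (c : ℝ) (x : R3) :
    partialMean (‖φ ·‖ ^ 2) (fun p => w p - c) x = partialMean (‖φ ·‖ ^ 2) w x - c := by
  have hn : Integrable (‖φ ·‖ ^ 2) volume := hφ.integrable_norm_pow two_ne_zero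
  obtain ⟨B, hB⟩ := hw.exists_abs_le
  simp only [partialMean, sub_mul]
  rw [integral_sub (integrable_slice_mul hn hw.contDiff.continuous hB x) (hn.const_mul c),
    integral_const_mul, hφ₁, mul_one]

lemma exists_correlation (hA : ∀ j : Fin 3, L2Loc (fun x => A x j)) (hφ : φ ∈ pekarDomain A 1) :
    ∃ w, BoundedSmooth w ∧ BoundedSmooth (partialMean (‖φ ·‖ ^ 2) w) ∧ (∀ p, w p.swap = w p) ∧
      ∫ p, w p * ‖productState φ p‖ ^ 2 = 0 ∧
      ∫ p, w p * coulombDensity φ p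
        ≠ 2 * ∫ p : R3 × R3, partialMean (‖φ ·‖ ^ 2) w p.1 * coulombDensity φ p := by
  obtain ⟨hH, hφ₁⟩ := hφ
  have hk := integrable_coulombDensity hA hH
  have hk₀ : 0 ≤ ∫ p, coulombDensity φ p :=
    integral_nonneg fun p => by rw [coulombDensity]; positivity
  obtain ⟨b, hb, hmb, hsymm, hpos, hlt⟩ := exists_diagonal_bump_coulomb_lt hA hH hφ₁
  set m := ∫ p, b p * ‖productState φ p‖ ^ 2
  have hmean := partialMean_sub_const hH.1 hφ₁ hb m
  refine ⟨fun p => b p - m, hb.sub_const m, ?_, fun p => congrArg (· - m) (hsymm p),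
    ?_, ne_of_gt ?_⟩
  · simpa only [← funext hmean] using hmb.sub_const m
  · have hn := (memLp_productState hH.1).integrable_norm_pow two_ne_zero
    simp only [sub_mul]
    rw [integral_sub (hb.integrable_mul hn) (hn.const_mul m), integral_const_mul,
      integral_norm_sq_productState hφ₁, mul_one, sub_self]
  · have hint : Integrable (fun p : R3 × R3 =>
        partialMean (‖φ ·‖ ^ 2) b p.1 * coulombDensity φ p) volume :=
      (hmb.comp_continuousLinearMap (.fst ℝ R3 R3)).integrable_mul hk
    simp only [hmean, sub_mul]
    rw [integral_sub (hb.integrable_mul hk) (hk.const_mul m),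
      integral_sub hint (hk.const_mul m), integral_const_mul]
    linarith [mul_nonneg hpos.le hk₀]

end DiagonalBump

section Strictness

variable {A : R3 → R3} {V : R3 → ℝ}

lemma IsPekarMinimizer.pekarEnergy_one_eq {φ : R3 → ℂ} (hφ : IsPekarMinimizer A V φ) :
    pekarEnergy A V 1 = (pekar A V φ : EReal) :=
  le_antisymm (iInf₂_le φ hφ.1)
    (le_iInf₂ fun χ hχ => EReal.coe_le_coe_iff.2 (isMinOn_iff.1 hφ.2 χ hχ))

lemma tendsto_pekarTomasevich (ψ : R3 × R3 → ℂ) (U : ℝ) :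
    Filter.Tendsto (fun U => pekarTomasevich A V U ψ) (nhds U)
      (nhds (pekarTomasevich A V U ψ)) := by
  unfold pekarTomasevich
  exact Continuous.tendsto (by fun_prop) U

lemma exists_gt_forall_pairEnergy_lt {ψ : R3 × R3 → ℂ} (hψ : ψ ∈ H1Pair A)
    (hψ₁ : ∫ p, ‖ψ p‖ ^ 2 = 1) {U₀ c : ℝ} (hlt : pekarTomasevich A V U₀ ψ < c) :
    ∃ U₁ > U₀, ∀ U, U₀ < U → U < U₁ → pairEnergy A V U < (c : EReal) := by
  obtain ⟨U₁, hU₁, hsub⟩ := exists_Ico_subset_of_mem_nhds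
    ((tendsto_pekarTomasevich ψ U₀).eventually_lt_const hlt) (exists_gt U₀)
  refine ⟨U₁, hU₁, fun U hU hU' => ?_⟩
  calc pairEnergy A V U ≤ (pekarTomasevich A V U ψ : EReal) := iInf₂_le ψ ⟨hψ, hψ₁⟩
    _ < (c : EReal) := EReal.coe_lt_coe_iff.2 (hsub ⟨hU.le, hU'⟩)

end Strictness

end Polaron

theorem theorem3p1_general (A : Polaron.R3 → Polaron.R3) (V : Polaron.R3 → ℝ)
    (hA : ∀ j : Fin 3, Polaron.L2Loc (fun x => A x j)) (φ : Polaron.R3 → ℂ)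
    (hφ : Polaron.IsPekarMinimizer A V φ)
    (hVφ : Integrable (fun x => V x * ‖φ x‖ ^ 2) volume) :
    ∃ UA : ℝ, 2 < UA ∧ ∀ U : ℝ, 2 < U → U < UA →
      Polaron.pairEnergy A V U < 2 * Polaron.pekarEnergy A V 1 := by
  obtain ⟨w, hw, hmw, hsymm, hmean, hne⟩ := Polaron.exists_correlation hA hφ.1
  obtain ⟨ψ, hψ, hψ₁, hlt⟩ :=
    hφ.exists_pekarTomasevich_two_lt hA hVφ hw hsymm hmw hmean hne
  rw [hφ.pekarEnergy_one_eq]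
  exact_mod_cast Polaron.exists_gt_forall_pairEnergy_lt hψ hψ₁ hlt

theorem theorem3p1 (A : Polaron.R3 → Polaron.R3) (V : Polaron.R3 → ℝ)
    (hA : ∀ j : Fin 3, Polaron.L2Loc (fun x => A x j))
    (hV : Polaron.L2Loc V)
    (hVsmall : Polaron.InfinitesimallySmall V)
    (hmin : ∃ φ₀ : Polaron.R3 → ℂ, Polaron.IsPekarMinimizer A V φ₀) :
    ∃ UA : ℝ, 2 < UA ∧ ∀ U : ℝ, 2 < U → U < UA →
      Polaron.pairEnergy A V U < 2 * Polaron.pekarEnergy A V 1 := by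
  obtain ⟨φ, hφ⟩ := hmin
  exact theorem3p1_general A V hA φ hφ
    (Polaron.integrable_potential_mul_norm_sq hA hV hVsmall hφ.1.1)
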